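/- **Setting.** Let $\mathcal X$ be a predictor space, partitioned into the leaves $l_1,\dots,l_m$ of a fixed binary tree, and let $\mathcal X=p_1\supseteq p_2\supseteq\dots\supseteq p_d\supseteq p_{d+1}=l_1$ be the regions on the path from the root to $l_1$, each a union of leaves. At $p_h$ there are $k_h\ge 1$ candidate splits, the $k$-th dividing $p_h$ into $p_h^k$ and $p_h\setminus p_h^k$; the observed split is $k=1$, with $p_h^1=p_{h+1}$. For each sample size $n$ let $X_{1,n},\dots,X_{n,n}\in\mathcal X$ be fixed predictors, and write $n_R$ for the number of $i\le n$ with $X_{i,n}\in R$, and $n_R^1=n_{R\cap l_1}$, $n_1=n_{l_1}$. Let $Y_{i,n}$ $(i\le n)$ be independent $\mathrm{Bernoulli}(\theta_{i,n})$ variables with $\theta_{i,n}=\sum_{j}\pi_{j,n}\mathbf 1[X_{i,n}\in l_j]$, and let $\epsilon_1,\dots,\epsilon_d\in\mathbb R$ and $\mathcal I:(0,1)\to\mathbb R$ be fixed. *Key statistics.* Let $\hat\pi_R=n_R^{-1}\sum_i Y_{i,n}\mathbf 1[X_{i,n}\in R]$, $\hat\pi_1=\hat\pi_{l_1}$, and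 $\hat\pi_{-1}(R)=\sqrt{n_R}\,\hat\pi_R-\frac{n^1_R}{\sqrt{n_1n_R}}\sqrt{n_1}\,\hat\pi_1$. The vector $\hat T_n=(\hat T_{n,1},\hat T_{n,-1})\in\mathbb R^{\bar k}$, $\bar k=1+\sum_hk_h$, has $\hat T_{n,1}=\sqrt{n_1}\,\hat\pi_1$, and $\hat T_{n,-1}$ has the entries $\hat\pi_{-1}(p_h)$ and $\hat\pi_{-1}(p_h^k)$, $2\le k\le k_h$, $h\le d$. Then $\hat T_n=n^{-1/2}\sum_ia_{i,n}Y_{i,n}$, where the entry of $a_{i,n}$ is $\sqrt{n/n_1}\,\mathbf 1[X_{i,n}\in l_1]$ for $l_1$ and $\sqrt{n/n_R}\,\big(\mathbf 1[X_{i,n}\in R]-\frac{n_R^1}{n_1}\mathbf 1[X_{i,n}\in l_1]\big)$ for $R=p_h,p_h^k$. Put $\Pi_n=n^{-1/2}\sum_i\theta_{i,n}a_{i,n}$ and $\Sigma_n=n^{-1}\sum_i\theta_{i,n}(1-\theta_{i,n})a_{i,n}a_{i,n}^\top=\mathrm{diag}(\sigma_{n,1}^2,\Sigma_{n,-1})$,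 where $\Sigma_{n,-1}$ is the block of the entries of $\hat T_{n,-1}$. Let $\zeta_n=\Sigma_n^{-1/2}(\hat T_n-\Pi_n)$ and $Z_n=n^{-1/2}\sum_i b_{i,n}Z_{i,n}$, with $b_{i,n}=\sqrt{\theta_{i,n}(1-\theta_{i,n})}\,\Sigma_n^{-1/2}a_{i,n}$ and $Z_{1,n},\dots,Z_{n,n}$ independent standard normal. *Gains.* Write $t=(u,v)\in\mathbb R^{\bar k}$, with $v^h,v^{h,k}$ the coordinates of $v$ in the places of $\hat\pi_{-1}(p_h),\hat\pi_{-1}(p_h^k)$ in $\hat T_{n,-1}$, and $v^{d+1}=0$. For $h\le d$, $k\le k_h$ let $z=v^{h+1}$ if $k=1$ and $z=v^{h,k}$ if $k\ge2$, let $P=p_h$, $S=p_h^k$, and $$q_1=\tfrac{\sqrt{n_1}}{n_P}u+\tfrac{1}{\sqrt{n_P}}v^h,\qquad q_2=\tfrac{n_S^1}{n_S\sqrt{n_1}}u+\tfrac1{\sqrt{n_S}}z,\qquad q_3=\tfrac{n_P^1-n_S^1}{(n_P-n_S)\sqrt{n_1}}u+\tfrac{\sqrt{n_P}}{n_P-n_S}v^h-\tfrac{\sqrt{n_S}}{n_P-n_S}z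 .$$ These are the sample proportions in $P$, $S$, $P\setminus S$ when $t=\hat T_n$. Let $\tilde D_n$ be the set of $t$ for which $q_1,q_2,q_3\in(0,1)$ for all $h,k$; on $\tilde D_n$ let $\mathcal G_h^k(t)=\mathcal I(q_1)-\frac{n_S}{n_P}\mathcal I(q_2)-\big(1-\frac{n_S}{n_P}\big)\mathcal I(q_3)$ and $\lambda_h(t)=e^{\epsilon_h\mathcal G_h^1(t)}/\sum_{k=1}^{k_h}e^{\epsilon_h\mathcal G_h^k(t)}$, and let $\lambda_h=0$ off $\tilde D_n$. Let $D_n=\{\zeta\in\mathbb R^{\bar k}:\Sigma_n^{1/2}\zeta+\Pi_n\in\tilde D_n\}$. For $\zeta=(\zeta_1,\zeta_{-1})\in D_n$ put $\Lambda(\zeta)=\prod_{h=1}^d\lambda_h(\Sigma_n^{1/2}\zeta+\Pi_n)$ and $$P(\zeta)=\frac{\int_{-\infty}^{\sigma_{n,1}\zeta_1+\Pi_{n,1}}\phi(u;\Pi_{n,1},\sigma_{n,1}^2)\prod_{h}\lambda_h(u,\Sigma_{n,-1}^{1/2}\zeta_{-1}+\Pi_{n,-1})\,du}{\int_{-\infty}^{\infty}\phi(u;\Pi_{n,1},\sigma_{n,1}^2)\prod_{h}\lambda_h(u,\Sigma_{n,-1}^{1/2}\zeta_{-1}+\Pi_{n,-1})\,du},$$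 where $\phi(\cdot;\mu,\sigma^2)$ is the density of $\mathcal N(\mu,\sigma^2)$; off $D_n$ let $\Lambda=P=0$. **Assumptions.** (1) $n/n_R$ stays bounded as $n\to\infty$ for $R=l_1$ and for $R=p_h^k$, $R=p_h\setminus p_h^k$, for all $h\le d$, $k\le k_h$. (2) $\pi_{j,n}\in(0,1)$, $\liminf_n\pi_{j,n}>0$ and $\limsup_n\pi_{j,n}<1$ for every $j\le m$. (3) There are $b,B>0$ such that for all large $n$ the matrix $\Sigma_n$ is positive definite with all its eigenvalues in $(1/b^2,B^2)$. (4) $\mathcal I$ is bounded and three times differentiable on $(0,1)$, with bounded derivatives of orders $1,2,3$. **Theorem.** Under (1)–(4), $\mathbb E[\Lambda(Z_n)]>0$ for all large $n$, the expectations below exist for all large $n$, and, for every $h\in C^3(\mathbb R)$, as $n\to\infty$, $$\frac{\left|\mathbb E[\Lambda(\zeta_n)]-\mathbb E[\Lambda(Z_n)]\right|}{\mathbb E[\Lambda(Z_n)]}\to0,\qquad \frac{\left|\mathbb E[h\circ P(\zeta_n)\,\Lambda(\zeta_n)]-\mathbb E[h\circ P(Z_n)\,\Lambda(Z_n)]\right|}{\mathbb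 E[\Lambda(Z_n)]}\to0 .$$ -/

import Mathlib

open MeasureTheory ProbabilityTheory Filter Topology Set
open scoped MatrixOrder

noncomputable section

/-- A fitted classification tree on the predictor space `𝒳`, seen along the path from the root to
the leaf of interest.  It has `m + 1` leaves, `leaf 0` being the leaf of interest `l₁`, and `d`
observed splits on the path.  `node 0, …, node d` are the regions on the path (`node 0 = 𝒳`,
`node d = l₁`), so the region that is split at step `h : Fin d` is `node h.castSucc`, and the branch
that the path follows is `node h.succ`.  At step `h` there are `alt h + 1` candidate splits:
candidate `0` is the one that was observed, the others are its `alt h` competitors;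
`child h s` is one of the two subregions into which candidate `s` divides `node h.castSucc`
(for the observed split, the one on the path). -/
structure TreePath (𝒳 : Type*) where
  m : ℕ
  leaf : Fin (m + 1) → Set 𝒳
  leaf_disjoint : Pairwise fun j j' => Disjoint (leaf j) (leaf j')
  leaf_cover : ⋃ j, leaf j = univ
  d : ℕ
  node : Fin (d + 1) → Set 𝒳
  node_zero : node 0 = univ
  node_last : node (Fin.last d) = leaf 0
  /-- every region on the path is a union of leaves -/
  leaf_node : ∀ h j, leaf j ⊆ node h ∨ Disjoint (leaf j) (node h)
  alt : Fin d → ℕ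
  child : ∀ h : Fin d, Fin (alt h + 1) → Set 𝒳
  child_subset : ∀ h s, child h s ⊆ node h.castSucc
  child_observed : ∀ h, child h 0 = node h.succ

/-- A tree together with a triangular array of predictors `X n i`, `i ∈ [n]`, the leaf means
`prob n j = π_{j,n}`, the temperature parameters `eps h = ε_h`, and the information function
`info = 𝓘` (only its values on `(0, 1)` matter). -/
structure TreeModel (𝒳 : Type*) extends TreePath 𝒳 where
  X : ∀ n : ℕ, Fin n → 𝒳
  prob : ℕ → Fin (m + 1) → ℝ
  eps : Fin d → ℝ
  info : ℝ → ℝ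

namespace TreeModel

variable {𝒳 : Type*} (M : TreeModel 𝒳)

/-- Indices of the nuisance coordinates of the key statistics: `alt h + 1 = k_h` for each step `h`.
Index `(h, 0)` belongs to the region `p_h`, index `(h, s)` with `s ≠ 0` to the `s`-th competitor. -/
abbrev Nuis : Type := Σ h : Fin M.d, Fin (M.alt h + 1)

/-- Indices of all coordinates of the key statistics: `none` is the coordinate of the leaf `l₁`. -/
abbrev Coord : Type := Option M.Nuis

/-- The leaf of interest `l₁`. -/
def leafOne : Set 𝒳 := M.leaf 0

/-- The region `p_h` that is split at step `h`. -/
def parent (h : Fin M.d) : Set 𝒳 := M.node h.castSucc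

/-- The region to which a nuisance coordinate belongs. -/
def region (c : M.Nuis) : Set 𝒳 := if c.2 = 0 then M.parent c.1 else M.child c.1 c.2

/-- `1[X_{i,n} ∈ R]` -/
def ind (n : ℕ) (R : Set 𝒳) (i : Fin n) : ℝ := R.indicator (fun _ => (1 : ℝ)) (M.X n i)

/-- `n_R`, the number of observations in the region `R`. -/
def count (n : ℕ) (R : Set 𝒳) : ℝ := ({i : Fin n | M.X n i ∈ R}.ncard : ℝ)

/-- `θ_{i,n} = ∑_j π_{j,n} 1[X_{i,n} ∈ l_j]` -/
def theta (n : ℕ) (i : Fin n) : ℝ := ∑ j, M.prob n j * M.ind n (M.leaf j) i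

/-! ### The key statistics -/

/-- The sample proportion in the region `R` for the outcome vector `y`. -/
def propHat (n : ℕ) (R : Set 𝒳) (y : Fin n → ℝ) : ℝ :=
  (1 / M.count n R) * ∑ i, y i * M.ind n R i

/-- The sample proportion of `R`, orthogonalized against that of `l₁`. -/
def orthHat (n : ℕ) (R : Set 𝒳) (y : Fin n → ℝ) : ℝ :=
  √(M.count n R) * M.propHat n R y
    - M.count n (R ∩ M.leafOne) / √(M.count n M.leafOne * M.count n R)
      * (√(M.count n M.leafOne) * M.propHat n M.leafOne y)

/-- The vector `T̂_n` of key statistics, as a function of the outcome vector `y`. -/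
def keyStat (n : ℕ) (y : Fin n → ℝ) : M.Coord → ℝ
  | none => √(M.count n M.leafOne) * M.propHat n M.leafOne y
  | some c => M.orthHat n (M.region c) y

/-- The weights `a_{i,n}` in the linear representation of the key statistics.  (For the regions
`p_h ⊇ l₁` the ratio `n_{R ∩ l₁} / n_{l₁}` is `1`.) -/
def weight (n : ℕ) (i : Fin n) : M.Coord → ℝ
  | none => √(n / M.count n M.leafOne) * M.ind n M.leafOne i
  | some c => √(n / M.count n (M.region c)) *
      (M.ind n (M.region c) i
        - M.count n (M.region c ∩ M.leafOne) / M.count n M.leafOne * M.ind n M.leafOne i)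

/-- `Π_n`, the mean of the key statistics. -/
def mean (n : ℕ) : M.Coord → ℝ := fun c => (1 / √(n : ℝ)) * ∑ i, M.weight n i c * M.theta n i

/-- `Σ_n`, the covariance matrix of the key statistics. -/
def cov (n : ℕ) : Matrix M.Coord M.Coord ℝ := fun c c' =>
  (1 / (n : ℝ)) * ∑ i, M.theta n i * (1 - M.theta n i) * (M.weight n i c * M.weight n i c')

/-- `σ_{n,1}²`, the leading entry of `Σ_n`. -/
def varOne (n : ℕ) : ℝ := M.cov n none none

/-- `Σ_{n,-1}`, the block of `Σ_n` of the nuisance coordinates. -/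
def covNuis (n : ℕ) : Matrix M.Nuis M.Nuis ℝ := (M.cov n).submatrix some some

/-- The standardized statistic `ζ_n = Σ_n^{-1/2} (T̂_n - Π_n)`, as a function of the outcomes. -/
def zeta (n : ℕ) (y : Fin n → ℝ) : M.Coord → ℝ :=
  (CFC.sqrt (M.cov n))⁻¹.mulVec (M.keyStat n y - M.mean n)

/-- `b_{i,n} = √(θ_{i,n} (1 - θ_{i,n})) Σ_n^{-1/2} a_{i,n}` -/
def stdWeight (n : ℕ) (i : Fin n) : M.Coord → ℝ :=
  √(M.theta n i * (1 - M.theta n i)) • (CFC.sqrt (M.cov n))⁻¹.mulVec (M.weight n i)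

/-- `Z_n = n^{-1/2} ∑ b_{i,n} Z_{i,n}`, as a function of the vector `z` of the `Z_{i,n}`. -/
def gaussStat (n : ℕ) (z : Fin n → ℝ) : M.Coord → ℝ :=
  (1 / √(n : ℝ)) • ∑ i, z i • M.stdWeight n i

/-! ### Gains and sampling probabilities as functions of the key statistics -/

/-- The scaling vector `η_h^s` of the candidate split `s` at step `h`. -/
def eta (n : ℕ) (h : Fin M.d) (s : Fin (M.alt h + 1)) : Fin 8 → ℝ :=
  let n1 := M.count n M.leafOne
  let nP := M.count n (M.parent h)
  let nS := M.count n (M.child h s)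
  let nP1 := M.count n (M.parent h ∩ M.leafOne)
  let nS1 := M.count n (M.child h s ∩ M.leafOne)
  ![√n1 / nP, 1 / √nP, nS1 / (nS * √n1), 1 / √nS, (nP1 - nS1) / ((nP - nS) * √n1),
    √nP / (nP - nS), -√nS / (nP - nS), nS / nP]

/-- The domain `D(η)`; the entries `η 0, …, η 7` are `η₁, …, η₈`. -/
def gainDomain (η : Fin 8 → ℝ) : Set (ℝ × ℝ × ℝ) :=
  {p | η 0 * p.1 + η 1 * p.2.1 ∈ Ioo (0 : ℝ) 1 ∧ η 2 * p.1 + η 3 * p.2.2 ∈ Ioo (0 : ℝ) 1 ∧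
    η 4 * p.1 + η 5 * p.2.1 + η 6 * p.2.2 ∈ Ioo (0 : ℝ) 1}

/-- The function `g_η`. -/
def gainFun (η : Fin 8 → ℝ) (p : ℝ × ℝ × ℝ) : ℝ :=
  M.info (η 0 * p.1 + η 1 * p.2.1) - η 7 * M.info (η 2 * p.1 + η 3 * p.2.2)
    - (1 - η 7) * M.info (η 4 * p.1 + η 5 * p.2.1 + η 6 * p.2.2)

/-- The triple of coordinates of `t = (u, v)` on which the gain of candidate `s` at step `h` depends:
`(u, v^h, v^{h+1})` for the observed split, where `v^{h+1}` is the coordinate of `p_{h+1}`, and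
`(u, v^h, v^{h,s})` for a competitor.  At the last step `p_{h+1}` is the leaf `l₁` itself, whose
orthogonalized proportion is `0`. -/
def triple (t : M.Coord → ℝ) (h : Fin M.d) (s : Fin (M.alt h + 1)) : ℝ × ℝ × ℝ :=
  (t none, t (some ⟨h, 0⟩),
    if s = 0 then
      (if hd : (h : ℕ) + 1 < M.d then t (some ⟨⟨(h : ℕ) + 1, hd⟩, 0⟩) else 0)
    else t (some ⟨h, s⟩))

/-- The domain `D̃_n` of the gain functions. -/
def gainDom (n : ℕ) : Set (M.Coord → ℝ) :=
  {t | ∀ h s, M.triple t h s ∈ gainDomain (M.eta n h s)}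

/-- The gain `𝒢_h^s` as a function of the key statistics. -/
def gain (n : ℕ) (h : Fin M.d) (s : Fin (M.alt h + 1)) (t : M.Coord → ℝ) : ℝ :=
  M.gainFun (M.eta n h s) (M.triple t h s)

/-- The probability `λ_h` of the observed split at step `h`, extended by `0` outside `D̃_n`. -/
def splitProb (n : ℕ) (h : Fin M.d) : (M.Coord → ℝ) → ℝ :=
  (M.gainDom n).indicator fun t =>
    Real.exp (M.eps h * M.gain n h 0 t) / ∑ s, Real.exp (M.eps h * M.gain n h s t)

/-! ### The weight `Λ` and the pivot `P` in terms of standardized variables -/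

/-- The domain `D_n`. -/
def stdDom (n : ℕ) : Set (M.Coord → ℝ) :=
  {x | (CFC.sqrt (M.cov n)).mulVec x + M.mean n ∈ M.gainDom n}

/-- The function `Λ`, which is `0` outside `D_n`. -/
def Lam (n : ℕ) : (M.Coord → ℝ) → ℝ :=
  (M.stdDom n).indicator fun x =>
    ∏ h, M.splitProb n h ((CFC.sqrt (M.cov n)).mulVec x + M.mean n)

/-- The integrand `φ(u; Π_{n,1}, σ_{n,1}²) ∏_h λ_h(u, Σ_{n,-1}^{1/2} x_{-1} + Π_{n,-1})`. -/
def pivotIntegrand (n : ℕ) (x : M.Coord → ℝ) (u : ℝ) : ℝ :=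
  gaussianPDFReal (M.mean n none) (M.varOne n).toNNReal u *
    ∏ h, M.splitProb n h (fun c => c.elim u fun j =>
      (CFC.sqrt (M.covNuis n)).mulVec (fun j' => x (some j')) j + M.mean n (some j))

/-- The pivot `P`, which is `0` outside `D_n`. -/
def pivot (n : ℕ) : (M.Coord → ℝ) → ℝ :=
  (M.stdDom n).indicator fun x =>
    (∫ u in Iic (√(M.varOne n) * x none + M.mean n none), M.pivotIntegrand n x u) /
      ∫ u, M.pivotIntegrand n x u

/-! ### The assumptions -/

/-- `n / n_R` stays bounded as `n → ∞` (in particular if it has a finite limit). -/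
def GrowsProportionally (R : Set 𝒳) : Prop :=
  ∃ C : ℝ, ∀ᶠ n : ℕ in atTop, 0 < M.count n R ∧ (n : ℝ) / M.count n R ≤ C

/-- The sizes of `l₁` and of both subregions of every candidate split are proportional to `n`. -/
def SampleGrowth : Prop :=
  M.GrowsProportionally M.leafOne ∧
    ∀ h s, M.GrowsProportionally (M.child h s) ∧ M.GrowsProportionally (M.parent h \ M.child h s)

/-- The leaf means lie in `(0, 1)` and are bounded away from `0` and `1`. -/
def MeansBounded : Prop :=
  (∀ n j, M.prob n j ∈ Ioo (0 : ℝ) 1) ∧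
    ∀ j, 0 < liminf (fun n => M.prob n j) atTop ∧ limsup (fun n => M.prob n j) atTop < 1

/-- For large `n`, `Σ_n` is positive definite with eigenvalues bounded away from `0` and `∞`. -/
def CovNondegenerate : Prop :=
  ∃ b B : ℝ, 0 < b ∧ 0 < B ∧ ∀ᶠ n : ℕ in atTop, (M.cov n).PosDef ∧
    ∀ κ ∈ spectrum ℝ (M.cov n), 1 / b ^ 2 < κ ∧ κ < B ^ 2

/-- `𝓘` is bounded and three times differentiable on `(0, 1)`, with bounded derivatives. -/
def InfoRegular : Prop :=
  (∀ j < 3, DifferentiableOn ℝ (iteratedDeriv j M.info) (Ioo 0 1)) ∧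
    ∃ C : ℝ, ∀ j ≤ 3, ∀ x ∈ Ioo (0 : ℝ) 1, |iteratedDeriv j M.info x| ≤ C

end TreeModel

/-- `Y` is a Bernoulli variable with success probability `q`, with values `1` and `0`. -/
def IsBernoulli {Ω : Type*} [MeasurableSpace Ω] (μ : Measure Ω) (Y : Ω → ℝ) (q : ℝ) : Prop :=
  ∃ p : unitInterval, (p : ℝ) = q ∧ HasLaw Y (bernoulliMeasure (1 : ℝ) 0 p) μ

end

/-! ### Weighted sums of independent Bernoulli variables and their normal limit. -/

noncomputable section

/-! The key statistics are scaled by `√n`, but the selection probability depends on them only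
through sample proportions. Hence a displacement of order one of `T̂_n` moves each proportion by
`O(n^{-1/2})`, and on that scale the product of the `λ_h` is almost constant. Let `L_n` be its value
at `Π_n`. There all proportions are averages of the `θ_{i,n}`, so they stay in some `[δ, 1 - δ]`.
Since `𝓘` is bounded and Lipschitz on `(0, 1)`, `L_n ≥ c > 0` and `|Λ(x) - L_n| ≤ C (1 + ∑ |x_c|) /
√n` for every `x`, inside or outside `D_n` (`abs_eta_le`, `gainFun_perturb`,
`exists_pathProb_lipschitz`).

With a nearly constant weight, the ratio of integrals defining `P(x)` is nearly the unweighted one,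
which is `Φ(x_1)`, with `Φ` the standard normal distribution function. So `P(x) = Φ(x_1) + O((1 + ∑
|x_c|) / √n)` on `D_n` (`abs_gaussian_ratio_sub_cdf_le`, `exists_Lam_pivot_approx`).

The coordinates of `ζ_n` and of `Z_n` have variance one, hence first absolute moments at most one.
Integrating the pointwise estimates gives `E[h(P) Λ] = L_n E[h(Φ(x_1))] + o(1)` for both vectors
(`tendsto_integral_test_sub`). Only the leading coordinate remains: it is exactly standard normal
for `Z_n`, and asymptotically so for `ζ_n` by a one-dimensional central limit theorem
(`tendsto_integral_sum_bernoulli`). The case `h = 1` shows that the denominator is eventually at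
least `c / 2`, so the absolute errors are also relative ones. -/

lemma norm_prod_sub_prod_le_sum {ι 𝕜 : Type*} [NormedField 𝕜] (s : Finset ι) (a b : ι → 𝕜)
    (ha : ∀ i ∈ s, ‖a i‖ ≤ 1) (hb : ∀ i ∈ s, ‖b i‖ ≤ 1) :
    ‖∏ i ∈ s, a i - ∏ i ∈ s, b i‖ ≤ ∑ i ∈ s, ‖a i - b i‖ := by
  classical
  induction s using Finset.induction_on with
  | empty => simp
  | insert j s hj ih =>
    rw [Finset.prod_insert hj, Finset.prod_insert hj, Finset.sum_insert hj]
    -- Factors are exchanged one at a time; the others have norm at most one and do not enlarge the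
    -- error. The bound serves for characteristic functions and for products of split probabilities.
    have e : a j * ∏ i ∈ s, a i - b j * ∏ i ∈ s, b i
        = (a j - b j) * ∏ i ∈ s, a i + b j * (∏ i ∈ s, a i - ∏ i ∈ s, b i) := by ring
    have h1 : ‖∏ i ∈ s, a i‖ ≤ 1 := by
      rw [norm_prod]
      exact Finset.prod_le_one (fun _ _ => norm_nonneg _)
        fun i hi => ha i (Finset.mem_insert_of_mem hi)
    have h2 := ih (fun i hi => ha i (Finset.mem_insert_of_mem hi))
      (fun i hi => hb i (Finset.mem_insert_of_mem hi))
    have h3 := hb j (Finset.mem_insert_self _ _)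
    calc _ ≤ ‖a j - b j‖ * ‖∏ i ∈ s, a i‖ + ‖b j‖ * ‖∏ i ∈ s, a i - ∏ i ∈ s, b i‖ := by
            rw [e]; exact (norm_add_le _ _).trans (by rw [norm_mul, norm_mul])
      _ ≤ ‖a j - b j‖ * 1 + 1 * ‖∏ i ∈ s, a i - ∏ i ∈ s, b i‖ := by gcongr
      _ ≤ _ := by linarith

lemma IsBernoulli.mem_Icc {Ω : Type*} [MeasurableSpace Ω] {μ : Measure Ω} {Y : Ω → ℝ} {q : ℝ}
    (h : IsBernoulli μ Y q) : q ∈ Icc (0 : ℝ) 1 := by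
  obtain ⟨p, rfl, -⟩ := h; exact p.2

lemma IsBernoulli.aemeasurable {Ω : Type*} [MeasurableSpace Ω] {μ : Measure Ω} {Y : Ω → ℝ} {q : ℝ}
    (h : IsBernoulli μ Y q) : AEMeasurable Y μ := by
  obtain ⟨p, -, h⟩ := h; exact h.aemeasurable

lemma IsBernoulli.integral_comp {Ω E : Type*} [MeasurableSpace Ω] {μ : Measure Ω} {Y : Ω → ℝ}
    {q : ℝ} (h : IsBernoulli μ Y q) [NormedAddCommGroup E] [NormedSpace ℝ E] [CompleteSpace E]
    {f : ℝ → E} (hf : Continuous f) :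
    ∫ ω, f (Y ω) ∂μ = q • f 1 + (1 - q) • f 0 := by
  obtain ⟨p, rfl, h⟩ := h
  have := h.integral_comp (f := f) hf.aestronglyMeasurable
  simp only [Function.comp_def] at this
  rw [this, integral_bernoulliMeasure]

lemma IsBernoulli.integrable_comp {Ω E : Type*} [MeasurableSpace Ω] {μ : Measure Ω} {Y : Ω → ℝ}
    {q : ℝ} (h : IsBernoulli μ Y q) [NormedAddCommGroup E]
    (f : ℝ → E) : Integrable (fun ω => f (Y ω)) μ := by
  obtain ⟨p, rfl, h⟩ := h
  have := integrable_bernoulliMeasure (1 : ℝ) 0 p f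
  rw [← h.map_eq] at this
  exact this.comp_aemeasurable h.aemeasurable

lemma norm_exp_I_mul_sub_quadratic_le {x : ℝ} (hx : |x| ≤ 1) :
    ‖Complex.exp (x * Complex.I) - (1 + x * Complex.I - (x : ℂ) ^ 2 / 2)‖ ≤ |x| ^ 3 := by
  have hn : ‖(x : ℂ) * Complex.I‖ = |x| := by simp
  have h := Complex.exp_bound (x := x * Complex.I) (by rw [hn]; exact hx) (n := 3) (by norm_num)
  rw [hn] at h
  have e : ∑ m ∈ Finset.range 3, ((x : ℂ) * Complex.I) ^ m / m.factorial
      = 1 + x * Complex.I - (x : ℂ) ^ 2 / 2 := by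
    simp [Finset.sum_range_succ, mul_pow, Nat.factorial]; ring
  rw [e] at h
  refine h.trans ?_
  have : 0 ≤ |x| ^ 3 := by positivity
  norm_num [Nat.factorial]
  linarith

/-- The characteristic function of a small multiple of a centered Bernoulli variable. -/
lemma IsBernoulli.norm_charFun_sub_le {Ω : Type*} [MeasurableSpace Ω] {μ : Measure Ω}
    [IsProbabilityMeasure μ] {Y : Ω → ℝ} {q : ℝ} (h : IsBernoulli μ Y q) (w t : ℝ)
    (hs : |t * w| ≤ 1) :
    ‖charFun (μ.map fun ω => w * (Y ω - q)) t
      - Complex.exp (-((t ^ 2 * (w ^ 2 * (q * (1 - q))) / 2 : ℝ) : ℂ))‖ ≤ 2 * |t * w| ^ 3 := by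
  have hq := h.mem_Icc
  have hY := h.aemeasurable
  have e1 : charFun (μ.map fun ω => w * (Y ω - q)) t
      = q * Complex.exp ((t * w * (1 - q) : ℝ) * Complex.I)
        + (1 - q) * Complex.exp ((t * w * (0 - q) : ℝ) * Complex.I) := by
    rw [charFun_apply_real, integral_map (by fun_prop) (by fun_prop)]
    have := h.integral_comp (f := fun y : ℝ => Complex.exp (t * ((w * (y - q) : ℝ) : ℂ) * Complex.I))
      (by fun_prop)
    rw [this]
    simp only [Complex.real_smul]
    push_cast
    ring_nf
  set s := t * w with hs_def
  have b1 : |s * (1 - q)| ≤ |s| := by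
    rw [abs_mul]
    exact mul_le_of_le_one_right (abs_nonneg _) (abs_le.2 ⟨by linarith [hq.2], by linarith [hq.1]⟩)
  have b0 : |s * (0 - q)| ≤ |s| := by
    rw [abs_mul]
    exact mul_le_of_le_one_right (abs_nonneg _) (abs_le.2 ⟨by linarith [hq.2], by linarith [hq.1]⟩)
  have c1 := norm_exp_I_mul_sub_quadratic_le (b1.trans hs)
  have c0 := norm_exp_I_mul_sub_quadratic_le (b0.trans hs)
  have d1 : |s * (1 - q)| ^ 3 ≤ |s| ^ 3 := by gcongr
  have d0 : |s * (0 - q)| ^ 3 ≤ |s| ^ 3 := by gcongr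
  set v := s ^ 2 * (q * (1 - q)) / 2 with hv
  have hv_eq : t ^ 2 * (w ^ 2 * (q * (1 - q))) / 2 = v := by rw [hv, hs_def]; ring
  have hs2 : s ^ 2 ≤ 1 := by rw [← sq_abs]; exact pow_le_one₀ (abs_nonneg _) hs
  have hqq : q * (1 - q) ≤ 1 := by nlinarith [hq.1, hq.2]
  have hqq0 : 0 ≤ q * (1 - q) := mul_nonneg hq.1 (by linarith [hq.2])
  have hv0 : 0 ≤ v := by rw [hv]; positivity
  have hvs : v ≤ s ^ 2 / 2 := by
    rw [hv]; gcongr; exact mul_le_of_le_one_right (sq_nonneg _) hqq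
  have c2 : |Real.exp (-v) - (1 - v)| ≤ |s| ^ 3 := by
    have h2 := Real.exp_bound (x := -v) (by rw [abs_neg, abs_of_nonneg hv0]; linarith)
      (n := 2) (by norm_num)
    have e : ∑ m ∈ Finset.range 2, (-v) ^ m / m.factorial = 1 - v := by
      simp [Finset.sum_range_succ]; ring
    rw [e] at h2
    refine h2.trans ?_
    rw [abs_neg, abs_of_nonneg hv0]
    have : v ^ 2 ≤ |s| ^ 3 := by
      calc v ^ 2 ≤ (s ^ 2 / 2) ^ 2 := by gcongr
        _ = |s| ^ 3 * |s| / 4 := by rw [← sq_abs s]; ring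
        _ ≤ |s| ^ 3 * 1 / 4 := by gcongr
        _ ≤ |s| ^ 3 := by have : 0 ≤ |s| ^ 3 := by positivity
                          linarith
    norm_num [Nat.factorial]
    have : 0 ≤ v ^ 2 := sq_nonneg v
    linarith
  rw [e1, hv_eq]
  -- Under the weights `q` and `1 - q` the linear terms cancel and the quadratic ones add up to `v`.
  -- Three Taylor remainders are left, each controlled by `|s| ^ 3`.
  have key : (q : ℂ) * Complex.exp ((s * (1 - q) : ℝ) * Complex.I)
        + (1 - q) * Complex.exp ((s * (0 - q) : ℝ) * Complex.I) - Complex.exp (-(v : ℂ))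
      = q * (Complex.exp ((s * (1 - q) : ℝ) * Complex.I)
          - (1 + (s * (1 - q) : ℝ) * Complex.I - ((s * (1 - q) : ℝ) : ℂ) ^ 2 / 2))
        + (1 - q : ℝ) * (Complex.exp ((s * (0 - q) : ℝ) * Complex.I)
          - (1 + (s * (0 - q) : ℝ) * Complex.I - ((s * (0 - q) : ℝ) : ℂ) ^ 2 / 2))
        - ((Real.exp (-v) - (1 - v) : ℝ) : ℂ) := by
    rw [hv]; push_cast; ring
  rw [key]
  have n1 : ‖(q : ℂ)‖ = q := by simp [abs_of_nonneg hq.1]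
  have n0 : ‖((1 - q : ℝ) : ℂ)‖ = 1 - q := by
    rw [Complex.norm_real, Real.norm_eq_abs, abs_of_nonneg (by linarith [hq.2])]
  calc _ ≤ q * |s| ^ 3 + (1 - q) * |s| ^ 3 + |s| ^ 3 := by
        refine (norm_sub_le _ _).trans (add_le_add ((norm_add_le _ _).trans (add_le_add ?_ ?_)) ?_)
        · rw [norm_mul, n1]; exact mul_le_mul_of_nonneg_left (c1.trans d1) hq.1
        · rw [norm_mul, n0]; exact mul_le_mul_of_nonneg_left (c0.trans d0) (by linarith [hq.2])
        · rw [Complex.norm_real]; exact c2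
    _ = _ := by ring

section Sums

variable {Ω : ℕ → Type*} [∀ n, MeasurableSpace (Ω n)] {μ : ∀ n, Measure (Ω n)}
  [∀ n, IsProbabilityMeasure (μ n)]

/-- Each factor of the characteristic function is within `O(n^{-3/2})` of a Gaussian factor of the
same variance, so `n` factors cost `O(n^{-1/2})`. The uniform bound on the weights plays the role of
a Lindeberg condition. -/
lemma tendsto_charFun_sum_bernoulli {Y : ∀ n : ℕ, Fin n → Ω n → ℝ} {q w : ∀ n, Fin n → ℝ}
    (hindep : ∀ n, iIndepFun (Y n) (μ n)) (hlaw : ∀ n i, IsBernoulli (μ n) (Y n i) (q n i))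
    {C : ℝ} (hw : ∀ᶠ n : ℕ in atTop, ∀ i, |w n i| ≤ C / √n)
    (hvar : ∀ᶠ n in atTop, ∑ i, w n i ^ 2 * (q n i * (1 - q n i)) = 1) (t : ℝ) :
    Tendsto (fun n => charFun ((μ n).map fun ω => ∑ i, w n i * (Y n i ω - q n i)) t) atTop
      (𝓝 (Complex.exp (-(t : ℂ) ^ 2 / 2))) := by
  have hlim : Tendsto (fun n : ℕ => (√n)⁻¹) atTop (𝓝 0) :=
    tendsto_inv_atTop_zero.comp (Real.tendsto_sqrt_atTop.comp tendsto_natCast_atTop_atTop)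
  have hsmall : ∀ᶠ n : ℕ in atTop, |t| * (C / √n) ≤ 1 := by
    have : Tendsto (fun n : ℕ => |t| * C * (√n)⁻¹) atTop (𝓝 0) := by
      simpa using hlim.const_mul (|t| * C)
    filter_upwards [this.eventually (eventually_le_nhds one_pos)] with n hn
    rw [div_eq_mul_inv, ← mul_assoc]; exact hn
  rw [tendsto_iff_norm_sub_tendsto_zero]
  refine squeeze_zero' (g := fun n : ℕ => 2 * (|t| * C) ^ 3 * (√n)⁻¹)
    (Eventually.of_forall fun _ => norm_nonneg _) ?_ (by simpa using hlim.const_mul _)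
  filter_upwards [hw, hvar, hsmall, eventually_gt_atTop 0] with n hw hvar hsmall hn
  have hmeas : ∀ i, AEMeasurable (fun ω => w n i * (Y n i ω - q n i)) (μ n) := fun i =>
    ((hlaw n i).aemeasurable.sub_const _).const_mul _
  have hind : iIndepFun (fun i ω => w n i * (Y n i ω - q n i)) (μ n) :=
    (hindep n).comp (fun i x => w n i * (x - q n i)) (fun i => by fun_prop)
  have hprob : ∀ i, IsProbabilityMeasure ((μ n).map fun ω => w n i * (Y n i ω - q n i)) :=
    fun i => Measure.isProbabilityMeasure_map (hmeas i)
  rw [hind.charFun_map_fun_sum_eq_prod hmeas, Finset.prod_apply]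
  -- The variances sum to one, so the Gaussian limit splits into one factor per summand.
  have e : Complex.exp (-(t : ℂ) ^ 2 / 2)
      = ∏ i, Complex.exp (-((t ^ 2 * (w n i ^ 2 * (q n i * (1 - q n i))) / 2 : ℝ) : ℂ)) := by
    rw [← Complex.exp_sum]
    congr 1
    rw [Finset.sum_neg_distrib, ← Complex.ofReal_sum, ← Finset.sum_div, ← Finset.mul_sum, hvar]
    push_cast; ring
  have hs : ∀ i, |t * w n i| ≤ |t| * (C / √n) := fun i => by
    rw [abs_mul]; exact mul_le_mul_of_nonneg_left (hw i) (abs_nonneg _)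
  rw [e]
  refine (norm_prod_sub_prod_le_sum _ _ _ (fun i _ => norm_charFun_le_one _) fun i _ => ?_).trans ?_
  · rw [← Complex.ofReal_neg, ← Complex.ofReal_exp, Complex.norm_real, Real.norm_eq_abs,
      abs_of_pos (Real.exp_pos _), Real.exp_le_one_iff, neg_nonpos]
    have := (hlaw n i).mem_Icc
    have h1 : 0 ≤ 1 - q n i := by linarith [this.2]
    have h0 := this.1
    positivity
  · calc _ ≤ ∑ i : Fin n, 2 * (|t| * (C / √n)) ^ 3 := Finset.sum_le_sum fun i _ =>
          ((hlaw n i).norm_charFun_sub_le _ _ ((hs i).trans hsmall)).trans (by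
            gcongr; exact hs i)
      _ = _ := by
        have hn' : (0 : ℝ) < n := by exact_mod_cast hn
        have : (n : ℝ) = √n * √n := (Real.mul_self_sqrt hn'.le).symm
        have h0 : √(n : ℝ) ≠ 0 := (Real.sqrt_pos.2 hn').ne'
        simp only [Finset.sum_const, Finset.card_univ, Fintype.card_fin, nsmul_eq_mul]
        nth_rw 1 [this]
        field_simp

/-- Central limit theorem for weighted sums of centered Bernoulli variables. -/
lemma tendsto_integral_sum_bernoulli {Y : ∀ n : ℕ, Fin n → Ω n → ℝ} {q w : ∀ n, Fin n → ℝ}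
    (hindep : ∀ n, iIndepFun (Y n) (μ n)) (hlaw : ∀ n i, IsBernoulli (μ n) (Y n i) (q n i))
    {C : ℝ} (hw : ∀ᶠ n : ℕ in atTop, ∀ i, |w n i| ≤ C / √n)
    (hvar : ∀ᶠ n in atTop, ∑ i, w n i ^ 2 * (q n i * (1 - q n i)) = 1)
    (f : BoundedContinuousFunction ℝ ℝ) :
    Tendsto (fun n => ∫ ω, f (∑ i, w n i * (Y n i ω - q n i)) ∂(μ n)) atTop
      (𝓝 (∫ x, f x ∂(gaussianReal 0 1))) := by
  have hmeas : ∀ n, AEMeasurable (fun ω => ∑ i, w n i * (Y n i ω - q n i)) (μ n) := fun n =>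
    Finset.aemeasurable_fun_sum _ fun i _ => ((hlaw n i).aemeasurable.sub_const _).const_mul _
  let ν : ℕ → ProbabilityMeasure ℝ := fun n =>
    ⟨(μ n).map fun ω => ∑ i, w n i * (Y n i ω - q n i), Measure.isProbabilityMeasure_map (hmeas n)⟩
  let γ : ProbabilityMeasure ℝ := ⟨gaussianReal 0 1, inferInstance⟩
  have h : Tendsto ν atTop (𝓝 γ) := by
    refine ProbabilityMeasure.tendsto_iff_tendsto_charFun.2 fun t => ?_
    have := tendsto_charFun_sum_bernoulli hindep hlaw hw hvar t
    have e : charFun (gaussianReal 0 1) t = Complex.exp (-(t : ℂ) ^ 2 / 2) := by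
      rw [charFun_gaussianReal]; congr 1; simp; ring
    simpa only [ν, γ, ProbabilityMeasure.coe_mk, e] using this
  rw [ProbabilityMeasure.tendsto_iff_forall_integral_tendsto] at h
  refine (h f).congr fun n => ?_
  simp only [ν, ProbabilityMeasure.coe_mk]
  rw [integral_map (hmeas n) f.continuous.aestronglyMeasurable]

end Sums

/-! ### Moments of the standardized sums and continuity of distribution functions. -/

section Moments

variable {Ω ι : Type*} [MeasurableSpace Ω] {μ : Measure Ω} [IsProbabilityMeasure μ] [Fintype ι]

lemma hasLaw_sum_gaussian {Z : ι → Ω → ℝ} (hindep : iIndepFun Z μ)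
    (hlaw : ∀ i, HasLaw (Z i) (gaussianReal 0 1) μ) {w : ι → ℝ} (hw : ∑ i, w i ^ 2 = 1) :
    HasLaw (fun ω => ∑ i, w i * Z i ω) (gaussianReal 0 1) μ := by
  have hmeas : ∀ i, AEMeasurable (fun ω => w i * Z i ω) μ := fun i =>
    (hlaw i).aemeasurable.const_mul _
  have hind : iIndepFun (fun i ω => w i * Z i ω) μ :=
    hindep.comp (fun i x => w i * x) (fun i => by fun_prop)
  refine ⟨Finset.aemeasurable_fun_sum _ fun i _ => hmeas i, ?_⟩
  have : IsProbabilityMeasure (μ.map fun ω => ∑ i, w i * Z i ω) :=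
    Measure.isProbabilityMeasure_map (Finset.aemeasurable_fun_sum _ fun i _ => hmeas i)
  refine Measure.ext_of_charFun (funext fun t => ?_)
  rw [hind.charFun_map_fun_sum_eq_prod hmeas, Finset.prod_apply]
  have (i : ι) : charFun (μ.map fun ω => w i * Z i ω) t
      = Complex.exp (-(t : ℂ) ^ 2 / 2 * (w i : ℂ) ^ 2) := by
    rw [charFun_map_mul_comp (hlaw i).aemeasurable, (hlaw i).map_eq, charFun_gaussianReal]
    congr 1; simp; ring
  simp_rw [this]
  rw [← Complex.exp_sum, ← Finset.mul_sum, charFun_gaussianReal]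
  have h2 : ∑ i, (w i : ℂ) ^ 2 = 1 := by exact_mod_cast hw
  rw [h2]; congr 1; simp; ring

/-- From `|x| ≤ (1 + x²) / 2`. First moments are all that is needed, because the approximation
errors grow linearly in the coordinates. -/
lemma integral_abs_le_one_of_integral_sq {X : Ω → ℝ} (hX : MemLp X 2 μ)
    (h : ∫ ω, X ω ^ 2 ∂μ ≤ 1) : Integrable X μ ∧ ∫ ω, |X ω| ∂μ ≤ 1 := by
  have hi : Integrable X μ := hX.integrable (by norm_num)
  refine ⟨hi, ?_⟩
  have hs := hX.integrable_sq
  calc ∫ ω, |X ω| ∂μ ≤ ∫ ω, (1 + X ω ^ 2) / 2 ∂μ := by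
        refine integral_mono hi.abs (((integrable_const 1).add hs).div_const 2) fun ω => ?_
        have := sq_nonneg (|X ω| - 1)
        simp only
        nlinarith [sq_abs (X ω)]
    _ ≤ 1 := by
        rw [integral_div, integral_add (integrable_const 1) hs]
        simp; linarith

lemma integral_abs_sum_bernoulli_le {Y : ι → Ω → ℝ} {q w : ι → ℝ}
    (hindep : iIndepFun Y μ) (hlaw : ∀ i, IsBernoulli μ (Y i) (q i))
    (hvar : ∑ i, w i ^ 2 * (q i * (1 - q i)) = 1) :
    Integrable (fun ω => ∑ i, w i * (Y i ω - q i)) μ ∧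
      ∫ ω, |∑ i, w i * (Y i ω - q i)| ∂μ ≤ 1 := by
  have hind : iIndepFun (fun i ω => w i * (Y i ω - q i)) μ :=
    hindep.comp (fun i x => w i * (x - q i)) (fun i => by fun_prop)
  have hmeas : ∀ i, AEMeasurable (fun ω => w i * (Y i ω - q i)) μ := fun i =>
    ((hlaw i).aemeasurable.sub_const _).const_mul _
  have hLp : ∀ i, MemLp (fun ω => w i * (Y i ω - q i)) 2 μ := fun i =>
    (memLp_two_iff_integrable_sq (hmeas i).aestronglyMeasurable).2
      ((hlaw i).integrable_comp fun y => (w i * (y - q i)) ^ 2)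
  have hmean : ∀ i, ∫ ω, w i * (Y i ω - q i) ∂μ = 0 := fun i => by
    rw [(hlaw i).integral_comp (f := fun y => w i * (y - q i)) (by fun_prop)]
    simp; ring
  have hv : ∀ i, variance (fun ω => w i * (Y i ω - q i)) μ = w i ^ 2 * (q i * (1 - q i)) :=
    fun i => by
      rw [variance_of_integral_eq_zero (hmeas i) (hmean i),
        (hlaw i).integral_comp (f := fun y => (w i * (y - q i)) ^ 2) (by fun_prop)]
      simp; ring
  have hS : MemLp (fun ω => ∑ i, w i * (Y i ω - q i)) 2 μ := memLp_finsetSum _ fun i _ => hLp i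
  refine integral_abs_le_one_of_integral_sq hS ?_
  have h0 : ∫ ω, ∑ i, w i * (Y i ω - q i) ∂μ = 0 := by
    rw [integral_finsetSum _ fun i _ => (hLp i).integrable (by norm_num)]
    simp [hmean]
  rw [← variance_of_integral_eq_zero hS.aemeasurable h0]
  have := IndepFun.variance_sum (s := Finset.univ) (fun i _ => hLp i)
    (fun i _ j _ hij => hind.indepFun hij)
  have e : (∑ i, fun ω => w i * (Y i ω - q i)) = fun ω => ∑ i, w i * (Y i ω - q i) := by
    ext; simp
  rw [e] at this
  rw [this, Finset.sum_congr rfl fun i _ => hv i, hvar]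

lemma integral_abs_sum_gaussian_le {Z : ι → Ω → ℝ} (hindep : iIndepFun Z μ)
    (hlaw : ∀ i, HasLaw (Z i) (gaussianReal 0 1) μ) {w : ι → ℝ} (hw : ∑ i, w i ^ 2 = 1) :
    Integrable (fun ω => ∑ i, w i * Z i ω) μ ∧ ∫ ω, |∑ i, w i * Z i ω| ∂μ ≤ 1 := by
  have h := hasLaw_sum_gaussian hindep hlaw hw
  have hid : MemLp (id : ℝ → ℝ) 2 (gaussianReal 0 1) := memLp_id_gaussianReal' 2 (by norm_num)
  have hS : MemLp (fun ω => ∑ i, w i * Z i ω) 2 μ := by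
    have := (memLp_map_measure_iff (μ := μ) (g := (id : ℝ → ℝ)) (p := 2) (by fun_prop)
      h.aemeasurable).1 (by rw [h.map_eq]; exact hid)
    exact this
  refine integral_abs_le_one_of_integral_sq hS ?_
  have := h.integral_comp (f := fun x => x ^ 2) (by fun_prop)
  simp only [Function.comp_def] at this
  rw [this]
  have e := variance_of_integral_eq_zero (μ := gaussianReal 0 1) (X := id) (by fun_prop) (by simp)
  rw [variance_id_gaussianReal] at e
  simp only [id] at e
  rw [← e]; simp

/-- The jump at a point is the mass of that point. This makes `h ∘ Φ` an admissible test function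
for weak convergence. -/
lemma continuous_cdf_of_noAtoms (ν : Measure ℝ) [IsProbabilityMeasure ν] [NullSingletonClass ν] :
    Continuous (cdf ν) := by
  rw [continuous_iff_continuousAt]
  intro x
  rw [(monotone_cdf ν).continuousAt_iff_leftLim_eq_rightLim, StieltjesFunction.rightLim_eq]
  have h := StieltjesFunction.measure_singleton (cdf ν) x
  rw [measure_cdf, measure_singleton] at h
  have h2 := ENNReal.ofReal_eq_zero.1 h.symm
  exact le_antisymm ((monotone_cdf ν).leftLim_le le_rfl) (by linarith)

end Moments

/-! ### Softmax probabilities. -/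

/-- Softmax probabilities are Lipschitz in the scores. -/
lemma softmax_sub_le {ι : Type*} [Fintype ι] (i₀ : ι) {G G' : ι → ℝ} {τ : ℝ}
    (h : ∀ i, |G i - G' i| ≤ τ) :
    Real.exp (G i₀) / ∑ i, Real.exp (G i) - Real.exp (G' i₀) / ∑ i, Real.exp (G' i) ≤ 2 * τ := by
  have hne : (Finset.univ : Finset ι).Nonempty := ⟨i₀, Finset.mem_univ _⟩
  have hS : 0 < ∑ i, Real.exp (G i) := Finset.sum_pos (fun _ _ => Real.exp_pos _) hne
  have hS' : 0 < ∑ i, Real.exp (G' i) := Finset.sum_pos (fun _ _ => Real.exp_pos _) hne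
  set S := ∑ i, Real.exp (G i)
  set S' := ∑ i, Real.exp (G' i)
  have h1 : S' ≤ Real.exp τ * S := by
    simp only [S, S', Finset.mul_sum, ← Real.exp_add]
    exact Finset.sum_le_sum fun i _ => Real.exp_le_exp.2 (by linarith [(abs_le.1 (h i)).1])
  have h2 : Real.exp (-τ) * Real.exp (G i₀) ≤ Real.exp (G' i₀) := by
    rw [← Real.exp_add]
    exact Real.exp_le_exp.2 (by linarith [(abs_le.1 (h i₀)).2])
  have hle : Real.exp (G i₀) ≤ S :=
    Finset.single_le_sum (f := fun i => Real.exp (G i)) (fun i _ => (Real.exp_pos _).le)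
      (Finset.mem_univ i₀)
  have hl1 : Real.exp (G i₀) / S ≤ 1 := (div_le_one hS).2 hle
  have hl0 : 0 ≤ Real.exp (G i₀) / S := by positivity
  -- The numerator shrinks by at most a factor `e^{-τ}` and the denominator grows by at most `e^τ`.
  -- The claim then follows from `1 - e^{-2τ} ≤ 2τ` and the fact that the probability is at most
  -- one.
  have h3 : Real.exp (-(2 * τ)) * (Real.exp (G i₀) / S) ≤ Real.exp (G' i₀) / S' := by
    rw [le_div_iff₀ hS']
    calc Real.exp (-(2 * τ)) * (Real.exp (G i₀) / S) * S'
        ≤ Real.exp (-(2 * τ)) * (Real.exp (G i₀) / S) * (Real.exp τ * S) := by gcongr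
      _ = (Real.exp (-(2 * τ)) * Real.exp τ) * Real.exp (G i₀) := by field_simp
      _ = Real.exp (-τ) * Real.exp (G i₀) := by rw [← Real.exp_add]; ring_nf
      _ ≤ _ := h2
  have h4 := Real.add_one_le_exp (-(2 * τ))
  have hτ : 0 ≤ τ := (abs_nonneg _).trans (h i₀)
  nlinarith

lemma softmax_mem_Icc {ι : Type*} [Fintype ι] (i₀ : ι) (G : ι → ℝ) :
    Real.exp (G i₀) / ∑ i, Real.exp (G i) ∈ Icc (0 : ℝ) 1 :=
  ⟨by positivity, div_le_one_of_le₀ (Finset.single_le_sum (f := fun i => Real.exp (G i))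
    (fun i _ => (Real.exp_pos _).le) (Finset.mem_univ i₀)) (by positivity)⟩

lemma le_softmax {ι : Type*} [Fintype ι] (i₀ : ι) {G : ι → ℝ} {B : ℝ} (h : ∀ i, |G i| ≤ B) :
    Real.exp (-B) / (Fintype.card ι * Real.exp B) ≤ Real.exp (G i₀) / ∑ i, Real.exp (G i) := by
  have hS : 0 < ∑ i, Real.exp (G i) :=
    Finset.sum_pos (fun _ _ => Real.exp_pos _) ⟨i₀, Finset.mem_univ _⟩
  gcongr
  · exact (abs_le.1 (h i₀)).1
  · calc _ ≤ ∑ _i : ι, Real.exp B :=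
          Finset.sum_le_sum fun i _ => Real.exp_le_exp.2 (abs_le.1 (h i)).2
      _ = _ := by simp

/-! ### Counts, sample proportions and the algebra of the key statistics. -/

namespace TreeModel

variable {𝒳 : Type*} (M : TreeModel 𝒳)

lemma ind_mem_Icc (n : ℕ) (R : Set 𝒳) (i : Fin n) : M.ind n R i ∈ Icc (0 : ℝ) 1 := by
  unfold ind; by_cases h : M.X n i ∈ R <;> simp [h]

lemma sum_ind (n : ℕ) (R : Set 𝒳) : ∑ i, M.ind n R i = M.count n R := by
  classical
  unfold ind count
  rw [Set.ncard_eq_toFinset_card']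
  simp [Set.indicator_apply]

lemma ind_diff {n : ℕ} {P S : Set 𝒳} (h : S ⊆ P) (i : Fin n) :
    M.ind n (P \ S) i = M.ind n P i - M.ind n S i := by
  unfold ind
  by_cases h1 : M.X n i ∈ S
  · simp [h1, h h1]
  · by_cases h2 : M.X n i ∈ P <;> simp [h1, h2]

lemma count_diff {n : ℕ} {P S : Set 𝒳} (h : S ⊆ P) :
    M.count n (P \ S) = M.count n P - M.count n S := by
  simp only [← sum_ind, M.ind_diff h, Finset.sum_sub_distrib]

lemma count_nonneg (n : ℕ) (R : Set 𝒳) : 0 ≤ M.count n R := by unfold count; positivity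

lemma count_mono {n : ℕ} {R R' : Set 𝒳} (h : R ⊆ R') : M.count n R ≤ M.count n R' := by
  unfold count
  have : {i : Fin n | M.X n i ∈ R} ⊆ {i | M.X n i ∈ R'} := fun i hi => h hi
  exact_mod_cast Set.ncard_le_ncard this (Set.toFinite _)

lemma count_le (n : ℕ) (R : Set 𝒳) : M.count n R ≤ n := by
  rw [← sum_ind]
  calc _ ≤ ∑ _i : Fin n, (1 : ℝ) := Finset.sum_le_sum fun i _ => (M.ind_mem_Icc n R i).2
    _ = n := by simp

lemma node_succ_subset (h : Fin M.d) : M.node h.succ ⊆ M.node h.castSucc := by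
  rw [← M.child_observed]; exact M.child_subset _ _

lemma leafOne_subset_node (h : Fin (M.d + 1)) : M.leafOne ⊆ M.node h := by
  induction h using Fin.reverseInduction with
  | last => exact M.node_last.ge
  | cast h ih => exact ih.trans (M.node_succ_subset h)

lemma leafOne_subset_parent (h : Fin M.d) : M.leafOne ⊆ M.parent h := M.leafOne_subset_node _

lemma theta_eq_prob (n : ℕ) (i : Fin n) : ∃ j, M.theta n i = M.prob n j := by
  have hx : M.X n i ∈ ⋃ j, M.leaf j := by rw [M.leaf_cover]; trivial
  obtain ⟨j, hj⟩ := mem_iUnion.1 hx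
  refine ⟨j, ?_⟩
  unfold theta
  rw [Finset.sum_eq_single j]
  · simp [ind, hj]
  · intro j' _ hne
    have : M.X n i ∉ M.leaf j' := fun h => (M.leaf_disjoint hne).le_bot ⟨h, hj⟩
    simp [ind, this]
  · simp

lemma exists_theta_bound (h : M.MeansBounded) :
    ∃ δ > 0, ∀ᶠ n in atTop, ∀ i, M.theta n i ∈ Icc δ (1 - δ) := by
  obtain ⟨h01, hlim⟩ := h
  have key : ∀ j, ∃ δ > 0, ∀ᶠ n in atTop, M.prob n j ∈ Icc δ (1 - δ) := by
    intro j
    obtain ⟨h1, h2⟩ := hlim j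
    have b1 : IsBoundedUnder (· ≥ ·) atTop fun n => M.prob n j :=
      isBoundedUnder_of ⟨0, fun n => (h01 n j).1.le⟩
    have b2 : IsBoundedUnder (· ≤ ·) atTop fun n => M.prob n j :=
      isBoundedUnder_of ⟨1, fun n => (h01 n j).2.le⟩
    have e1 := eventually_lt_of_lt_liminf (half_lt_self h1) b1
    have e2 := eventually_lt_of_limsup_lt (b := (limsup (fun n => M.prob n j) atTop + 1) / 2)
      (by linarith) b2
    -- Half the distance of the liminf from `0` and of the limsup from `1`; the slack makes the
    -- bounds hold eventually.
    refine ⟨min (liminf (fun n => M.prob n j) atTop / 2)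
      ((1 - limsup (fun n => M.prob n j) atTop) / 2), lt_min (by linarith) (by linarith), ?_⟩
    filter_upwards [e1, e2] with n e1 e2
    refine ⟨(min_le_left _ _).trans e1.le, ?_⟩
    have := min_le_right (liminf (fun n => M.prob n j) atTop / 2)
      ((1 - limsup (fun n => M.prob n j) atTop) / 2)
    linarith
  choose δ hδ hev using key
  refine ⟨Finset.univ.inf' Finset.univ_nonempty δ,
    (Finset.lt_inf'_iff _).2 fun j _ => hδ j, ?_⟩
  filter_upwards [eventually_all.2 hev] with n hn i
  obtain ⟨j, hj⟩ := M.theta_eq_prob n i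
  have := Finset.inf'_le δ (Finset.mem_univ j)
  rw [hj]
  exact ⟨this.trans (hn j).1, by linarith [(hn j).2]⟩

lemma propHat_mem_Icc {n : ℕ} {R : Set 𝒳} (hR : 0 < M.count n R) {y : Fin n → ℝ} {a b : ℝ}
    (hy : ∀ i, y i ∈ Icc a b) : M.propHat n R y ∈ Icc a b := by
  unfold propHat
  have h1 : a * M.count n R ≤ ∑ i, y i * M.ind n R i := by
    rw [← sum_ind, Finset.mul_sum]
    exact Finset.sum_le_sum fun i _ =>
      mul_le_mul_of_nonneg_right (hy i).1 (M.ind_mem_Icc n R i).1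
  have h2 : ∑ i, y i * M.ind n R i ≤ b * M.count n R := by
    rw [← sum_ind, Finset.mul_sum]
    exact Finset.sum_le_sum fun i _ =>
      mul_le_mul_of_nonneg_right (hy i).2 (M.ind_mem_Icc n R i).1
  rw [one_div, inv_mul_eq_div]
  exact ⟨(le_div_iff₀ hR).2 h1, (div_le_iff₀ hR).2 h2⟩

lemma propHat_diff {n : ℕ} {P S : Set 𝒳} (h : S ⊆ P) (hS : 0 < M.count n S)
    (hD : 0 < M.count n (P \ S)) (y : Fin n → ℝ) :
    (M.count n P - M.count n S) * M.propHat n (P \ S) y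
      = M.count n P * M.propHat n P y - M.count n S * M.propHat n S y := by
  have hd := M.count_diff (n := n) h
  have hP : 0 < M.count n P := by linarith
  unfold propHat
  rw [← hd]
  simp only [M.ind_diff h, mul_sub, Finset.sum_sub_distrib]
  field_simp

/-- Linear representation of the key statistics. -/
lemma keyStat_eq {n : ℕ} (hn : 0 < n) (y : Fin n → ℝ) (c : M.Coord) :
    M.keyStat n y c = (1 / √(n : ℝ)) * ∑ i, M.weight n i c * y i := by
  have hn' : (0 : ℝ) < n := by exact_mod_cast hn
  have hs : √(n : ℝ) ≠ 0 := (Real.sqrt_pos.2 hn').ne'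
  -- Also true for `a = 0`, where both sides are `0` by the convention for division, so empty
  -- regions need no exclusion.
  have key (a : ℝ) (ha : 0 ≤ a) : √a / a = (1 / √(n : ℝ)) * √(n / a) := by
    rw [Real.sqrt_div hn'.le, Real.sqrt_div_self]
    field_simp
  cases c with
  | none =>
    simp only [keyStat, weight, propHat]
    have e : ∑ i, √(n / M.count n M.leafOne) * M.ind n M.leafOne i * y i
        = √(n / M.count n M.leafOne) * ∑ i, y i * M.ind n M.leafOne i := by
      rw [Finset.mul_sum]; exact Finset.sum_congr rfl fun i _ => by ring
    rw [e, ← mul_assoc, ← mul_assoc, ← key _ (M.count_nonneg _ _)]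
    ring
  | some c =>
    simp only [keyStat, weight, propHat, orthHat]
    set R := M.region c
    have e : ∑ i, √(n / M.count n R) * (M.ind n R i
          - M.count n (R ∩ M.leafOne) / M.count n M.leafOne * M.ind n M.leafOne i) * y i
        = √(n / M.count n R) * (∑ i, y i * M.ind n R i
          - M.count n (R ∩ M.leafOne) / M.count n M.leafOne * ∑ i, y i * M.ind n M.leafOne i) := by
      rw [mul_sub, Finset.mul_sum, Finset.mul_sum, Finset.mul_sum, ← Finset.sum_sub_distrib]
      exact Finset.sum_congr rfl fun i _ => by ring
    rw [e, ← mul_assoc (1 / √(n : ℝ)), ← key _ (M.count_nonneg _ _), Real.sqrt_mul (M.count_nonneg _ _),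
      Real.sqrt_div_self]
    have h0 := M.count_nonneg n M.leafOne
    have h1 : √(M.count n R) * (1 / M.count n R) = 1 / √(M.count n R) := by
      rw [mul_one_div, Real.sqrt_div_self, one_div]
    rcases h0.eq_or_lt with h0 | h0
    · rw [← h0]; simp; rw [← one_div, ← mul_assoc, h1, one_div]
    · have hq := Real.mul_self_sqrt h0.le
      have hq0 := (Real.sqrt_pos.2 h0).ne'
      rw [← mul_assoc, h1]
      have h2 : M.count n (R ∩ M.leafOne) / (√(M.count n M.leafOne) * √(M.count n R)) *
          (√(M.count n M.leafOne) * (1 / M.count n M.leafOne * ∑ i, y i * M.ind n M.leafOne i))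
          = (1 / √(M.count n R)) * (M.count n (R ∩ M.leafOne) / M.count n M.leafOne
            * ∑ i, y i * M.ind n M.leafOne i) := by
        by_cases hR : √(M.count n R) = 0
        · simp [hR]
        · field_simp
      rw [h2]; ring

/-- By linearity. Consequently the proportions encoded by `Π_n` are averages of the `θ_{i,n}`,
bounded away from `0` and `1`. -/
lemma mean_eq_keyStat {n : ℕ} (hn : 0 < n) : M.mean n = M.keyStat n (M.theta n) :=
  funext fun c => (M.keyStat_eq hn _ c).symm

lemma orthHat_leafOne {n : ℕ} (h : 0 < M.count n M.leafOne) (y : Fin n → ℝ) :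
    M.orthHat n M.leafOne y = 0 := by
  unfold orthHat
  rw [inter_self, Real.sqrt_mul_self h.le, div_self h.ne', one_mul, sub_self]

lemma triple_keyStat {n : ℕ} (hn : 0 < M.count n M.leafOne) (y : Fin n → ℝ) (h : Fin M.d)
    (s : Fin (M.alt h + 1)) :
    M.triple (M.keyStat n y) h s = (√(M.count n M.leafOne) * M.propHat n M.leafOne y,
      M.orthHat n (M.parent h) y, M.orthHat n (M.child h s) y) := by
  unfold triple
  refine Prod.ext rfl (Prod.ext ?_ ?_)
  · simp [keyStat, region]
  · simp only
    split_ifs with hs hd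
    · subst hs
      have e : M.parent ⟨h + 1, hd⟩ = M.child h 0 := by
        rw [M.child_observed]; rfl
      simp [keyStat, region, e]
    -- At the last step the observed branch is `l₁`, whose orthogonalized proportion vanishes, in
    -- agreement with the default value in `triple`.
    · subst hs
      have e : M.child h 0 = M.leafOne := by
        rw [M.child_observed, leafOne, ← M.node_last]
        congr 1
        ext
        have := h.2
        simp; omega
      rw [e, M.orthHat_leafOne hn]
    · simp [keyStat, region, hs]

/-- The three arguments of `𝓘` in the gain are the sample proportions. -/
lemma eta_keyStat {n : ℕ} {h : Fin M.d} {s : Fin (M.alt h + 1)} (hn : 0 < M.count n M.leafOne)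
    (hS : 0 < M.count n (M.child h s)) (hD : 0 < M.count n (M.parent h \ M.child h s))
    (y : Fin n → ℝ) :
    let p := M.triple (M.keyStat n y) h s
    let η := M.eta n h s
    η 0 * p.1 + η 1 * p.2.1 = M.propHat n (M.parent h) y ∧
    η 2 * p.1 + η 3 * p.2.2 = M.propHat n (M.child h s) y ∧
    η 4 * p.1 + η 5 * p.2.1 + η 6 * p.2.2 = M.propHat n (M.parent h \ M.child h s) y := by
  intro p η
  have hsub : M.child h s ⊆ M.parent h := M.child_subset h s
  have hd := M.count_diff (n := n) hsub
  have hP : 0 < M.count n (M.parent h) := by linarith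
  have hdiff := M.propHat_diff hsub hS hD y
  have hcap : M.parent h ∩ M.leafOne = M.leafOne :=
    inter_eq_right.2 (M.leafOne_subset_parent h)
  rw [hd] at hD
  simp only [p, η, M.triple_keyStat hn]
  simp only [eta, orthHat, hcap, Matrix.cons_val]
  rw [Real.sqrt_mul hn.le, Real.sqrt_mul hn.le]
  set A := M.propHat n M.leafOne y
  set B := M.propHat n (M.parent h) y
  set C := M.propHat n (M.child h s) y
  set D := M.propHat n (M.parent h \ M.child h s) y
  set k := M.count n (M.child h s ∩ M.leafOne)
  -- With the roots of the counts as variables, the three claims become rational identities.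
  obtain ⟨a, ha, ha'⟩ : ∃ a, 0 < a ∧ M.count n M.leafOne = a ^ 2 :=
    ⟨_, Real.sqrt_pos.2 hn, (Real.sq_sqrt hn.le).symm⟩
  obtain ⟨b, hb, hb'⟩ : ∃ a, 0 < a ∧ M.count n (M.parent h) = a ^ 2 :=
    ⟨_, Real.sqrt_pos.2 hP, (Real.sq_sqrt hP.le).symm⟩
  obtain ⟨c, hc, hc'⟩ : ∃ a, 0 < a ∧ M.count n (M.child h s) = a ^ 2 :=
    ⟨_, Real.sqrt_pos.2 hS, (Real.sq_sqrt hS.le).symm⟩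
  rw [hb', hc'] at hD hdiff
  rw [ha', hb', hc', Real.sqrt_sq ha.le, Real.sqrt_sq hb.le, Real.sqrt_sq hc.le]
  refine ⟨by field_simp; ring, by field_simp; ring, ?_⟩
  have hD' := hD.ne'
  have : D = (b ^ 2 * B - c ^ 2 * C) / (b ^ 2 - c ^ 2) := by
    rw [eq_div_iff hD', ← hdiff]; ring
  rw [this]
  field_simp
  ring

/-- Enlarging a constant preserves its bound, so one constant serves the finitely many regions. In
product form the inequality also forces the counts to be positive. -/
lemma exists_growth (h : M.SampleGrowth) : ∃ C : ℝ, 1 ≤ C ∧ ∀ᶠ n : ℕ in atTop, 0 < n ∧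
    (n : ℝ) ≤ C * M.count n M.leafOne ∧ ∀ h s, (n : ℝ) ≤ C * M.count n (M.child h s) ∧
      (n : ℝ) ≤ C * M.count n (M.parent h \ M.child h s) := by
  have key (R : Set 𝒳) (hR : M.GrowsProportionally R) :
      ∀ᶠ C : ℝ in atTop, ∀ᶠ n : ℕ in atTop, (n : ℝ) ≤ C * M.count n R := by
    obtain ⟨C, hC⟩ := hR
    filter_upwards [eventually_ge_atTop C] with C' hC'
    filter_upwards [hC] with n hn
    exact ((div_le_iff₀ hn.1).1 hn.2).trans (mul_le_mul_of_nonneg_right hC' hn.1.le)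
  have h1 := key _ h.1
  have h2 : ∀ᶠ C : ℝ in atTop, ∀ h s, ∀ᶠ n : ℕ in atTop, (n : ℝ) ≤ C * M.count n (M.child h s) :=
    eventually_all.2 fun i => eventually_all.2 fun s => key _ (h.2 i s).1
  have h3 : ∀ᶠ C : ℝ in atTop, ∀ h s, ∀ᶠ n : ℕ in atTop,
      (n : ℝ) ≤ C * M.count n (M.parent h \ M.child h s) :=
    eventually_all.2 fun i => eventually_all.2 fun s => key _ (h.2 i s).2
  obtain ⟨C, h1, h2, h3, hC⟩ := (h1.and (h2.and (h3.and (eventually_ge_atTop 1)))).exists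
  refine ⟨C, hC, ?_⟩
  filter_upwards [h1, eventually_all.2 fun i => eventually_all.2 (h2 i),
    eventually_all.2 fun i => eventually_all.2 (h3 i), eventually_gt_atTop 0] with n h1 h2 h3 hn
  exact ⟨hn, h1, fun i s => ⟨h2 i s, h3 i s⟩⟩

lemma one_div_sqrt_le {n a C : ℝ} (hn : 0 < n) (hC : 1 ≤ C) (h : n ≤ C * a) :
    1 / √a ≤ C / √n := by
  have ha : 0 < a := by
    by_contra hc; nlinarith
  rw [div_le_div_iff₀ (Real.sqrt_pos.2 ha) (Real.sqrt_pos.2 hn), one_mul]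
  refine (Real.sqrt_le_left (by positivity)).2 ?_
  rw [mul_pow, Real.sq_sqrt ha.le]
  nlinarith

lemma sqrt_div_le {n a b C : ℝ} (hn : 0 < n) (h : n ≤ C * a) (ha : 0 < a) (hb : b ≤ n) :
    √b / a ≤ C / √n := by
  have hsn := Real.sqrt_pos.2 hn
  rw [div_le_div_iff₀ ha hsn]
  calc √b * √n ≤ √n * √n := by gcongr
    _ = n := Real.mul_self_sqrt hn.le
    _ ≤ C * a := h

/-- All the counts in the denominators are comparable with `n`. This is the source of the factor
`n^{-1/2}` in the whole argument; the remaining entry `n_S / n_P` is a mixing weight and does not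
multiply a coordinate. -/
lemma abs_eta_le {n : ℕ} {h : Fin M.d} {s : Fin (M.alt h + 1)} {C : ℝ} (hC : 1 ≤ C) (hn : 0 < n)
    (h1 : (n : ℝ) ≤ C * M.count n M.leafOne) (hS : (n : ℝ) ≤ C * M.count n (M.child h s))
    (hD : (n : ℝ) ≤ C * M.count n (M.parent h \ M.child h s)) :
    (∀ j : Fin 8, j ≠ 7 → |M.eta n h s j| ≤ C / √n) ∧ M.eta n h s 7 ∈ Icc (0 : ℝ) 1 := by
  have hn' : (0 : ℝ) < n := by exact_mod_cast hn
  have pos {R : Set 𝒳} (h : (n : ℝ) ≤ C * M.count n R) : 0 < M.count n R := by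
    by_contra hc; nlinarith
  have p1 := pos h1
  have pS := pos hS
  have pD := pos hD
  have hsub : M.child h s ⊆ M.parent h := M.child_subset h s
  have hd := M.count_diff (n := n) hsub
  have hd1 := M.count_diff (n := n) (inter_subset_inter_left M.leafOne hsub)
  have hd2 : M.count n ((M.parent h ∩ M.leafOne) \ (M.child h s ∩ M.leafOne))
      ≤ M.count n (M.parent h \ M.child h s) :=
    M.count_mono fun x hx => ⟨hx.1.1, fun hc => hx.2 ⟨hc, hx.1.2⟩⟩
  have hSP := M.count_mono (n := n) hsub
  have hP : (n : ℝ) ≤ C * M.count n (M.parent h) := hS.trans (by gcongr)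
  have pP := pos hP
  have hsn := Real.sqrt_pos.2 hn'
  have ab {x : ℝ} (hx : 0 ≤ x) (h : x ≤ C / √n) : |x| ≤ C / √n := by rwa [abs_of_nonneg hx]
  have prop {a b : ℝ} (hb : 0 < b) (hab : a ≤ b) :
      a / (b * √(M.count n M.leafOne)) ≤ C / √n := by
    refine le_trans ?_ (one_div_sqrt_le hn' hC h1)
    rw [div_mul_eq_div_div]
    gcongr
    exact (div_le_one hb).2 hab
  have hnn := M.count_nonneg n (M.child h s ∩ M.leafOne)
  have hnn2 := M.count_nonneg n ((M.parent h ∩ M.leafOne) \ (M.child h s ∩ M.leafOne))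
  constructor
  · intro j hj
    fin_cases j <;> simp only [eta] <;> simp [-one_div] at hj ⊢
    · exact ab (by positivity) (sqrt_div_le hn' hP pP (M.count_le _ _))
    · exact ab (by positivity) (one_div_sqrt_le hn' hC hP)
    · exact ab (by positivity) (prop pS (M.count_mono inter_subset_left))
    · exact ab (by positivity) (one_div_sqrt_le hn' hC hS)
    -- The numerator counts the observations of `l₁` in `P \ S`, hence is at most `n_P - n_S`.
    · rw [← hd, ← hd1]
      exact ab (by positivity) (prop pD hd2)
    · rw [← hd]
      exact ab (by positivity) (sqrt_div_le hn' hD pD (M.count_le _ _))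
    · rw [← hd, abs_div, abs_neg, ← abs_div]
      exact ab (by positivity) (sqrt_div_le hn' hD pD (M.count_le _ _))
  · simp only [eta, Matrix.cons_val]
    exact ⟨by positivity, (div_le_one pP).2 hSP⟩

/-! ### Local behaviour of the gains and of the path probability. -/

lemma exists_info_lipschitz (h : M.InfoRegular) : ∃ C : ℝ, 0 ≤ C ∧
    (∀ x ∈ Ioo (0 : ℝ) 1, |M.info x| ≤ C) ∧
    ∀ x ∈ Ioo (0 : ℝ) 1, ∀ y ∈ Ioo (0 : ℝ) 1, |M.info x - M.info y| ≤ C * |x - y| := by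
  obtain ⟨hd, C, hC⟩ := h
  have h0 := hd 0 (by norm_num)
  rw [iteratedDeriv_zero] at h0
  refine ⟨C, ?_, fun x hx => by simpa using hC 0 (by norm_num) x hx, fun x hx y hy => ?_⟩
  · exact (abs_nonneg _).trans (hC 0 (by norm_num) (1 / 2) (by norm_num))
  · have := (convex_Ioo (0 : ℝ) 1).norm_image_sub_le_of_norm_deriv_le (f := M.info) (C := C)
      (fun z hz => h0.differentiableAt (isOpen_Ioo.mem_nhds hz))
      (fun z hz => by simpa using hC 1 (by norm_num) z hz) hy hx
    simpa using this

lemma continuousOn_info (h : M.InfoRegular) : ContinuousOn M.info (Ioo 0 1) := by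
  have h0 := h.1 0 (by norm_num)
  rw [iteratedDeriv_zero] at h0
  exact h0.continuousOn

/-- The product of the probabilities of the observed splits. -/
def pathProb (n : ℕ) (t : M.Coord → ℝ) : ℝ := ∏ h, M.splitProb n h t

lemma splitProb_mem_Icc (n : ℕ) (h : Fin M.d) (t : M.Coord → ℝ) :
    M.splitProb n h t ∈ Icc (0 : ℝ) 1 := by
  unfold splitProb
  by_cases ht : t ∈ M.gainDom n
  · rw [indicator_of_mem ht]
    exact softmax_mem_Icc 0 fun s => M.eps h * M.gain n h s t
  · simp [ht]

lemma pathProb_mem_Icc (n : ℕ) (t : M.Coord → ℝ) : M.pathProb n t ∈ Icc (0 : ℝ) 1 :=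
  ⟨Finset.prod_nonneg fun h _ => (M.splitProb_mem_Icc n h t).1,
    Finset.prod_le_one (fun h _ => (M.splitProb_mem_Icc n h t).1)
      fun h _ => (M.splitProb_mem_Icc n h t).2⟩

lemma pathProb_of_notMem {n : ℕ} {t : M.Coord → ℝ} (ht : t ∉ M.gainDom n) :
    M.pathProb n t = 0 := by
  -- Without splits the domain is the whole space, so a point outside it provides a step whose
  -- factor is zero.
  have : ∃ h : Fin M.d, True := by
    by_contra hc
    exact ht fun h => (hc ⟨h, trivial⟩).elim
  obtain ⟨h, -⟩ := this
  exact Finset.prod_eq_zero (Finset.mem_univ h) (by simp [splitProb, ht])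

lemma Lam_eq (n : ℕ) (x : M.Coord → ℝ) :
    M.Lam n x = M.pathProb n ((CFC.sqrt (M.cov n)).mulVec x + M.mean n) := by
  unfold Lam
  by_cases hx : x ∈ M.stdDom n
  · rw [indicator_of_mem hx]; rfl
  · rw [indicator_of_notMem hx, M.pathProb_of_notMem hx]

lemma abs_triple_sub_le {t t' : M.Coord → ℝ} {R : ℝ} (h : ∀ c, |t c - t' c| ≤ R) (k : Fin M.d)
    (s : Fin (M.alt k + 1)) :
    |(M.triple t k s).1 - (M.triple t' k s).1| ≤ R ∧
      |(M.triple t k s).2.1 - (M.triple t' k s).2.1| ≤ R ∧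
      |(M.triple t k s).2.2 - (M.triple t' k s).2.2| ≤ R := by
  refine ⟨h _, h _, ?_⟩
  unfold triple
  simp only
  split_ifs with h1 h2
  · exact h _
  · simpa using (abs_nonneg _).trans (h none)
  · exact h _

lemma abs_gainFun_le {C : ℝ} (hC : ∀ x ∈ Ioo (0 : ℝ) 1, |M.info x| ≤ C) {η : Fin 8 → ℝ}
    (hη : η 7 ∈ Icc (0 : ℝ) 1) {p : ℝ × ℝ × ℝ} (hp : p ∈ gainDomain η) :
    |M.gainFun η p| ≤ 2 * C := by
  obtain ⟨h1, h2, h3⟩ := hp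
  obtain ⟨k0, k1⟩ := hη
  have a1 := abs_le.1 (hC _ h1)
  have a2 := abs_le.1 (hC _ h2)
  have a3 := abs_le.1 (hC _ h3)
  unfold gainFun
  rw [abs_le]
  constructor <;> nlinarith

/-- Each argument of `𝓘` combines at most three coordinates with coefficients at most `a`, so it
moves by at most `3aR < δ` and stays in `(0, 1)`, where `𝓘` is Lipschitz. The factor `2` is the sum
`1 + η₈ + (1 - η₈)` of the weights. -/
lemma gainFun_perturb {C : ℝ} (hC0 : 0 ≤ C)
    (hC : ∀ x ∈ Ioo (0 : ℝ) 1, ∀ y ∈ Ioo (0 : ℝ) 1, |M.info x - M.info y| ≤ C * |x - y|)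
    {η : Fin 8 → ℝ} {a δ R : ℝ} (ha : ∀ j, j ≠ 7 → |η j| ≤ a) (hη : η 7 ∈ Icc (0 : ℝ) 1)
    {p p' : ℝ × ℝ × ℝ} (hδ : 3 * (a * R) < δ)
    (hp1 : η 0 * p.1 + η 1 * p.2.1 ∈ Icc δ (1 - δ)) (hp2 : η 2 * p.1 + η 3 * p.2.2 ∈ Icc δ (1 - δ))
    (hp3 : η 4 * p.1 + η 5 * p.2.1 + η 6 * p.2.2 ∈ Icc δ (1 - δ))
    (h1 : |p'.1 - p.1| ≤ R) (h2 : |p'.2.1 - p.2.1| ≤ R) (h3 : |p'.2.2 - p.2.2| ≤ R) :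
    p' ∈ gainDomain η ∧ |M.gainFun η p' - M.gainFun η p| ≤ 2 * (C * (3 * (a * R))) := by
  have hR : 0 ≤ R := (abs_nonneg _).trans h1
  have ha0 : 0 ≤ a := (abs_nonneg _).trans (ha 0 (by decide))
  have haR : 0 ≤ a * R := mul_nonneg ha0 hR
  have m {j : Fin 8} (hj : j ≠ 7) {x : ℝ} (hx : |x| ≤ R) : |η j * x| ≤ a * R := by
    rw [abs_mul]; exact mul_le_mul (ha j hj) hx (abs_nonneg _) ha0
  have d1 : |(η 0 * p'.1 + η 1 * p'.2.1) - (η 0 * p.1 + η 1 * p.2.1)| ≤ 3 * (a * R) := by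
    have e : (η 0 * p'.1 + η 1 * p'.2.1) - (η 0 * p.1 + η 1 * p.2.1)
      = η 0 * (p'.1 - p.1) + η 1 * (p'.2.1 - p.2.1) := by ring
    have m1 := m (j := 0) (by decide) h1
    have m2 := m (j := 1) (by decide) h2
    rw [e]; exact (abs_add_le _ _).trans (by linarith)
  have d2 : |(η 2 * p'.1 + η 3 * p'.2.2) - (η 2 * p.1 + η 3 * p.2.2)| ≤ 3 * (a * R) := by
    have e : (η 2 * p'.1 + η 3 * p'.2.2) - (η 2 * p.1 + η 3 * p.2.2)
      = η 2 * (p'.1 - p.1) + η 3 * (p'.2.2 - p.2.2) := by ring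
    have m1 := m (j := 2) (by decide) h1
    have m2 := m (j := 3) (by decide) h3
    rw [e]; exact (abs_add_le _ _).trans (by linarith)
  have d3 : |(η 4 * p'.1 + η 5 * p'.2.1 + η 6 * p'.2.2)
      - (η 4 * p.1 + η 5 * p.2.1 + η 6 * p.2.2)| ≤ 3 * (a * R) := by
    have e : (η 4 * p'.1 + η 5 * p'.2.1 + η 6 * p'.2.2)
      - (η 4 * p.1 + η 5 * p.2.1 + η 6 * p.2.2)
      = η 4 * (p'.1 - p.1) + η 5 * (p'.2.1 - p.2.1) + η 6 * (p'.2.2 - p.2.2) := by ring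
    have m1 := m (j := 4) (by decide) h1
    have m2 := m (j := 5) (by decide) h2
    have m3 := m (j := 6) (by decide) h3
    rw [e]
    refine (abs_add_le _ _).trans ?_
    linarith [abs_add_le (η 4 * (p'.1 - p.1)) (η 5 * (p'.2.1 - p.2.1))]
  have dom {x y : ℝ} (hx : x ∈ Icc δ (1 - δ)) (hxy : |y - x| ≤ 3 * (a * R)) :
      y ∈ Ioo (0 : ℝ) 1 := by
    obtain ⟨k1, k2⟩ := abs_le.1 hxy
    exact ⟨by linarith [hx.1], by linarith [hx.2]⟩
  have lip {x y : ℝ} (hx : x ∈ Icc δ (1 - δ)) (hxy : |y - x| ≤ 3 * (a * R)) :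
      |M.info y - M.info x| ≤ C * (3 * (a * R)) :=
    (hC y (dom hx hxy) x (dom hx (by simpa using haR))).trans
      (mul_le_mul_of_nonneg_left hxy hC0)
  refine ⟨⟨dom hp1 d1, dom hp2 d2, dom hp3 d3⟩, ?_⟩
  have l1 := abs_le.1 (lip hp1 d1)
  have l2 := abs_le.1 (lip hp2 d2)
  have l3 := abs_le.1 (lip hp3 d3)
  obtain ⟨k0, k1⟩ := hη
  unfold gainFun
  set τ := C * (3 * (a * R))
  rw [abs_le]
  constructor <;> nlinarith

/-- The sampling probability of the observed path is bounded away from zero at the mean of the key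
statistics, and varies there on the scale `√n`. -/
lemma exists_pathProb_lipschitz (hg : M.SampleGrowth) (hm : M.MeansBounded) (hi : M.InfoRegular) :
    ∃ C c : ℝ, 0 ≤ C ∧ 0 < c ∧ ∀ᶠ n : ℕ in atTop, c ≤ M.pathProb n (M.mean n) ∧
      ∀ (t : M.Coord → ℝ) (R : ℝ), (∀ c, |t c - M.mean n c| ≤ R) →
        |M.pathProb n t - M.pathProb n (M.mean n)| ≤ C * R / √n := by
  obtain ⟨K, hK1, hK⟩ := M.exists_growth hg
  obtain ⟨δ, hδ, hθ⟩ := M.exists_theta_bound hm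
  obtain ⟨C, hC0, hCb, hCl⟩ := M.exists_info_lipschitz hi
  set A := ∑ h : Fin M.d, 2 * (|M.eps h| * (2 * (C * (3 * K)))) with hA
  have hA0 : 0 ≤ A := Finset.sum_nonneg fun h _ => by positivity
  -- `A` is the Lipschitz constant near the mean and `3K / δ` covers distant points. The lower bound
  -- is the worst softmax value for gains of size at most `2C`.
  refine ⟨max A (3 * K / δ), ∏ h : Fin M.d, Real.exp (-(|M.eps h| * (2 * C))) /
    (Fintype.card (Fin (M.alt h + 1)) * Real.exp (|M.eps h| * (2 * C))),
    hA0.trans (le_max_left _ _), Finset.prod_pos fun h _ => by simp; positivity, ?_⟩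
  filter_upwards [hK, hθ] with n hK hθ
  obtain ⟨hn, hK1', hKs⟩ := hK
  have hn' : (0 : ℝ) < n := by exact_mod_cast hn
  have hsn := Real.sqrt_pos.2 hn'
  have pos {R : Set 𝒳} (h : (n : ℝ) ≤ K * M.count n R) : 0 < M.count n R := by
    by_contra hc; nlinarith
  have hη (h s) := M.abs_eta_le (h := h) (s := s) hK1 hn hK1' (hKs h s).1 (hKs h s).2
  have hq (h s) := M.eta_keyStat (h := h) (s := s) (pos hK1') (pos (hKs h s).1) (pos (hKs h s).2)
    (M.theta n)
  rw [← M.mean_eq_keyStat hn] at hq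
  have hpert (t : M.Coord → ℝ) (R : ℝ) (ht : ∀ c, |t c - M.mean n c| ≤ R)
      (hR : 3 * (K / √n * R) < δ) (h s) :
      M.triple t h s ∈ gainDomain (M.eta n h s) ∧
        |M.gain n h s t - M.gain n h s (M.mean n)| ≤ 2 * (C * (3 * (K / √n * R))) := by
    obtain ⟨q1, q2, q3⟩ := hq h s
    obtain ⟨t1, t2, t3⟩ := M.abs_triple_sub_le ht h s
    have pP : 0 < M.count n (M.parent h) :=
      (pos (hKs h s).1).trans_le (M.count_mono (M.child_subset h s))
    exact M.gainFun_perturb hC0 hCl (hη h s).1 (hη h s).2 hR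
      (q1 ▸ M.propHat_mem_Icc pP hθ) (q2 ▸ M.propHat_mem_Icc (pos (hKs h s).1) hθ)
      (q3 ▸ M.propHat_mem_Icc (pos (hKs h s).2) hθ) t1 t2 t3
  have hmean : M.mean n ∈ M.gainDom n := fun h s =>
    (hpert (M.mean n) 0 (by simp) (by simpa using hδ) h s).1
  refine ⟨?_, fun t R ht => ?_⟩
  · unfold pathProb
    refine Finset.prod_le_prod (fun h _ => by positivity) fun h _ => ?_
    unfold splitProb
    rw [indicator_of_mem hmean]
    refine le_softmax (G := fun s => M.eps h * M.gain n h s (M.mean n)) 0 fun s => ?_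
    rw [abs_mul]
    exact mul_le_mul_of_nonneg_left (M.abs_gainFun_le hCb (hη h s).2 (hmean h s)) (abs_nonneg _)
  · have hR0 : 0 ≤ R := (abs_nonneg _).trans (ht none)
    by_cases hR : 3 * (K / √n * R) < δ
    · have htd : t ∈ M.gainDom n := fun h s => (hpert t R ht hR h s).1
      have hsplit (h) : |M.splitProb n h t - M.splitProb n h (M.mean n)|
          ≤ 2 * (|M.eps h| * (2 * (C * (3 * (K / √n * R))))) := by
        unfold splitProb
        rw [indicator_of_mem hmean, indicator_of_mem htd]
        have hd (s) : |M.eps h * M.gain n h s t - M.eps h * M.gain n h s (M.mean n)|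
            ≤ |M.eps h| * (2 * (C * (3 * (K / √n * R)))) := by
          rw [← mul_sub, abs_mul]
          exact mul_le_mul_of_nonneg_left (hpert t R ht hR h s).2 (abs_nonneg _)
        rw [abs_le]
        have s1 := softmax_sub_le (G := fun s => M.eps h * M.gain n h s t)
          (G' := fun s => M.eps h * M.gain n h s (M.mean n)) 0 hd
        have s2 := softmax_sub_le (G := fun s => M.eps h * M.gain n h s (M.mean n))
          (G' := fun s => M.eps h * M.gain n h s t) 0 (fun s => by rw [abs_sub_comm]; exact hd s)
        constructor <;> linarith
      have := norm_prod_sub_prod_le_sum Finset.univ (fun h => M.splitProb n h t)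
        (fun h => M.splitProb n h (M.mean n))
        (fun h _ => by
          rw [Real.norm_eq_abs, abs_of_nonneg (M.splitProb_mem_Icc n h t).1]
          exact (M.splitProb_mem_Icc n h t).2)
        (fun h _ => by
          rw [Real.norm_eq_abs, abs_of_nonneg (M.splitProb_mem_Icc n h _).1]
          exact (M.splitProb_mem_Icc n h _).2)
      calc _ ≤ ∑ h, |M.splitProb n h t - M.splitProb n h (M.mean n)| := this
        _ ≤ ∑ h, 2 * (|M.eps h| * (2 * (C * (3 * (K / √n * R))))) :=
          Finset.sum_le_sum fun h _ => hsplit h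
        _ = A * R / √n := by
          rw [hA, Finset.sum_mul, Finset.sum_div]
          exact Finset.sum_congr rfl fun h _ => by ring
        _ ≤ _ := by gcongr; exact le_max_left _ _
    -- Far from the mean the domain may be left, but there `3KR / √n ≥ δ`, so the trivial bound `1`
    -- is good enough.
    · have h1 := M.pathProb_mem_Icc n t
      have h2 := M.pathProb_mem_Icc n (M.mean n)
      calc |M.pathProb n t - M.pathProb n (M.mean n)| ≤ 1 :=
            abs_le.2 ⟨by linarith [h1.1, h2.2], by linarith [h1.2, h2.1]⟩
        _ ≤ 3 * K / δ * R / √n := by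
          have e : 3 * K / δ * R / √n = 3 * (K / √n * R) / δ := by ring
          rw [e, le_div_iff₀ hδ]; linarith
        _ ≤ _ := by gcongr; exact le_max_right _ _

end TreeModel

/-! ### Bounds for square roots of matrices and their inverses. -/

section MatrixSqrt

variable {ι : Type*} [Fintype ι] [DecidableEq ι]

lemma transpose_cfcSqrt (A : Matrix ι ι ℝ) : (CFC.sqrt A).transpose = CFC.sqrt A := by
  have := (Matrix.nonneg_iff_posSemidef.1 (CFC.sqrt_nonneg A)).isHermitian
  rwa [Matrix.IsHermitian, Matrix.conjTranspose_eq_transpose_of_trivial] at this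

/-- The squared rows of a square root sum up to the diagonal of the matrix. -/
lemma sum_sq_cfcSqrt {A : Matrix ι ι ℝ} (hA : A.PosSemidef) (i : ι) :
    ∑ j, CFC.sqrt A i j ^ 2 = A i i := by
  conv_rhs => rw [← CFC.sqrt_mul_sqrt_self A hA.nonneg]
  rw [Matrix.mul_apply]
  refine Finset.sum_congr rfl fun j _ => ?_
  rw [sq]
  congr 1
  conv_lhs => rw [← transpose_cfcSqrt A]
  rfl

/-- The squared entries of a row of the root sum to a diagonal entry of `A`. As only the diagonal
enters, the bound passes from `Σ_n` to its nuisance block. -/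
lemma abs_cfcSqrt_mulVec_le {A : Matrix ι ι ℝ} (hA : A.PosSemidef) {B : ℝ} (hB : 0 ≤ B)
    (h : ∀ i, A i i ≤ B ^ 2) (x : ι → ℝ) (i : ι) :
    |(CFC.sqrt A).mulVec x i| ≤ B * ∑ j, |x j| := by
  have hS (j) : |CFC.sqrt A i j| ≤ B := by
    refine abs_le_of_sq_le_sq ?_ hB
    exact (Finset.single_le_sum (f := fun j => CFC.sqrt A i j ^ 2) (fun _ _ => sq_nonneg _)
      (Finset.mem_univ j)).trans ((sum_sq_cfcSqrt hA i).le.trans (h i))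
  rw [Matrix.mulVec, dotProduct, Finset.mul_sum]
  refine (Finset.abs_sum_le_sum_abs _ _).trans (Finset.sum_le_sum fun j _ => ?_)
  rw [abs_mul]
  exact mul_le_mul_of_nonneg_right (hS j) (abs_nonneg _)

lemma cfcSqrt_inv_mul_mul_inv {A : Matrix ι ι ℝ} (hA : A.PosDef) :
    (CFC.sqrt A)⁻¹ * A * (CFC.sqrt A)⁻¹ = 1 := by
  have hS := CFC.sqrt_mul_sqrt_self A hA.posSemidef.nonneg
  have hdet : IsUnit (CFC.sqrt A).det := by
    have h1 := congrArg Matrix.det hS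
    rw [Matrix.det_mul] at h1
    refine isUnit_iff_ne_zero.2 fun h0 => hA.det_pos.ne' ?_
    rw [← h1, h0, zero_mul]
  calc (CFC.sqrt A)⁻¹ * A * (CFC.sqrt A)⁻¹
      = (CFC.sqrt A)⁻¹ * (CFC.sqrt A * CFC.sqrt A) * (CFC.sqrt A)⁻¹ := by rw [hS]
    _ = 1 := by
      rw [← Matrix.mul_assoc, Matrix.nonsing_inv_mul _ hdet, Matrix.one_mul,
        Matrix.mul_nonsing_inv _ hdet]

lemma diag_le_of_spectrum_le {A : Matrix ι ι ℝ} (hA : A.PosDef) {B : ℝ}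
    (h : ∀ κ ∈ spectrum ℝ A, κ ≤ B) (i : ι) : A i i ≤ B := by
  have h1 := le_algebraMap_of_spectrum_le h hA.isHermitian.isSelfAdjoint
  have h2 := (Matrix.le_iff.1 h1).diag_nonneg (i := i)
  simpa [Matrix.algebraMap_matrix_apply] using h2

/-- For a row `r` of `A^{-1/2}`, the identity `A^{-1/2} A A^{-1/2} = 1` gives `r ⬝ A r = 1`, while
`A ≥ b⁻²` gives `r ⬝ A r ≥ |r|² / b²`. -/
lemma sum_sq_row_cfcSqrt_inv_le {A : Matrix ι ι ℝ} (hA : A.PosDef) {b : ℝ} (hb : 0 < b)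
    (h : ∀ κ ∈ spectrum ℝ A, 1 / b ^ 2 ≤ κ) (i : ι) :
    ∑ j, (CFC.sqrt A)⁻¹ i j ^ 2 ≤ b ^ 2 := by
  have h1 := algebraMap_le_of_le_spectrum h hA.isHermitian.isSelfAdjoint
  set r : ι → ℝ := (CFC.sqrt A)⁻¹ i with hr
  have h2 := (Matrix.le_iff.1 h1).dotProduct_mulVec_nonneg r
  have hT : ((CFC.sqrt A)⁻¹).transpose = (CFC.sqrt A)⁻¹ := by
    rw [Matrix.transpose_nonsing_inv, transpose_cfcSqrt]
  have h3 : r ⬝ᵥ A.mulVec r = 1 := by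
    have := congrFun (congrFun (cfcSqrt_inv_mul_mul_inv hA) i) i
    rw [Matrix.one_apply_eq, Matrix.mul_assoc] at this
    rw [← this, Matrix.mul_apply]
    refine Finset.sum_congr rfl fun j _ => ?_
    rw [Matrix.mul_apply]
    congr 1
    refine Finset.sum_congr rfl fun k _ => ?_
    congr 1
    conv_rhs => rw [← hT]
    rfl
  rw [Matrix.sub_mulVec, dotProduct_sub, star_trivial, h3, Algebra.algebraMap_eq_smul_one,
    Matrix.smul_mulVec, Matrix.one_mulVec, dotProduct_smul, smul_eq_mul] at h2
  have h4 : r ⬝ᵥ r = ∑ j, r j ^ 2 := Finset.sum_congr rfl fun j _ => (sq _).symm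
  rw [h4, one_div, inv_mul_eq_div, sub_nonneg, div_le_one (by positivity)] at h2
  exact h2

end MatrixSqrt

/-! ### Weighted Gaussian distribution functions. -/

section GaussianRatio

lemma integral_abs_gaussianReal_le : Integrable (fun w : ℝ => |w|) (gaussianReal 0 1) ∧
    ∫ w, |w| ∂(gaussianReal 0 1) ≤ 1 := by
  have hid : MemLp (id : ℝ → ℝ) 2 (gaussianReal 0 1) := memLp_id_gaussianReal' 2 (by norm_num)
  have e := variance_of_integral_eq_zero (μ := gaussianReal 0 1) (X := id) (by fun_prop) (by simp)
  rw [variance_id_gaussianReal] at e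
  have := integral_abs_le_one_of_integral_sq hid (by rw [← e]; simp)
  exact ⟨this.1.abs, this.2⟩

lemma integral_Iic_div_integral_mem_Icc {f : ℝ → ℝ} (hf : ∀ u, 0 ≤ f u) (a : ℝ) :
    (∫ u in Iic a, f u) / ∫ u, f u ∈ Icc (0 : ℝ) 1 := by
  refine ⟨div_nonneg (integral_nonneg hf) (integral_nonneg hf), ?_⟩
  by_cases hi : Integrable f
  · exact div_le_one_of_le₀ (setIntegral_le_integral hi (Eventually.of_forall hf))
      (integral_nonneg hf)
  · rw [integral_undef hi, div_zero]; exact zero_le_one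

/-- If a weight is nearly constant, then the weighted Gaussian distribution function is nearly the
standard one. -/
lemma abs_gaussian_ratio_sub_cdf_le {F : ℝ → ℝ} (hF : Measurable F) (hF01 : ∀ u, F u ∈ Icc (0 : ℝ) 1)
    {v m L c C r : ℝ} (hv : 0 < v) (hc : 0 < c) (hL : c ≤ L) (hC : 0 ≤ C)
    (hFL : ∀ w, |F (√v * w + m) - L| ≤ C * (|w| + r)) (a : ℝ) :
    |(∫ u in Iic (√v * a + m), gaussianPDFReal m v.toNNReal u * F u) /
        (∫ u, gaussianPDFReal m v.toNNReal u * F u) - cdf (gaussianReal 0 1) a|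
      ≤ 4 * (C * (1 + r)) / c := by
  set γ := gaussianReal 0 1 with hγ
  have hsv := Real.sqrt_pos.2 hv
  have hmap : γ.map (fun w => √v * w + m) = gaussianReal m v.toNNReal := by
    have h1 := gaussianReal_map_const_mul (μ := 0) (v := 1) √v
    have h2 := gaussianReal_map_add_const (μ := √v * 0)
      (v := (.mk (√v ^ 2) (sq_nonneg _) * 1 : NNReal)) m
    rw [← h1, Measure.map_map (by fun_prop) (by fun_prop)] at h2
    simp only [Function.comp_def, mul_zero, zero_add, mul_one] at h2
    rw [h2]
    congr 1
    ext
    simp [Real.sq_sqrt hv.le, hv.le]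
  have hint (f : ℝ → ℝ) (hf : Measurable f) :
      ∫ u, gaussianPDFReal m v.toNNReal u * f u = ∫ w, f (√v * w + m) ∂γ := by
    have := integral_gaussianReal_eq_integral_smul (μ := m) (v := v.toNNReal) (f := f)
      (by simpa using hv)
    simp only [smul_eq_mul] at this
    rw [← this, ← hmap, integral_map (by fun_prop) (by rw [hmap]; exact hf.aestronglyMeasurable)]
  have hN : ∫ u in Iic (√v * a + m), gaussianPDFReal m v.toNNReal u * F u
      = ∫ w in Iic a, F (√v * w + m) ∂γ := by
    rw [← integral_indicator measurableSet_Iic, ← integral_indicator measurableSet_Iic]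
    have := hint ((Iic (√v * a + m)).indicator F) (hF.indicator measurableSet_Iic)
    have e1 : (Iic (√v * a + m)).indicator (fun u => gaussianPDFReal m v.toNNReal u * F u)
        = fun u => gaussianPDFReal m v.toNNReal u * (Iic (√v * a + m)).indicator F u := by
      ext u; by_cases hu : u ∈ Iic (√v * a + m) <;> simp [hu]
    have e2 : (Iic a).indicator (fun w => F (√v * w + m))
        = fun w => (Iic (√v * a + m)).indicator F (√v * w + m) := by
      ext w
      have : √v * w + m ∈ Iic (√v * a + m) ↔ w ∈ Iic a := by
        simp [hsv]
      by_cases hw : w ∈ Iic a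
      · simp only [indicator_of_mem hw, indicator_of_mem (this.2 hw)]
      · simp only [indicator_of_notMem hw, indicator_of_notMem (fun h => hw (this.1 h))]
    rw [e1, e2, this]
  have hD := hint F hF
  set G : ℝ → ℝ := fun w => F (√v * w + m) with hG
  have hGm : Measurable G := hF.comp (by fun_prop)
  have hGi : Integrable G γ := by
    refine Integrable.of_bound hGm.aestronglyMeasurable 1 (Eventually.of_forall fun w => ?_)
    rw [Real.norm_eq_abs, abs_of_nonneg (hF01 _).1]; exact (hF01 _).2
  have hGLi : Integrable (fun w => |G w - L|) γ := (hGi.sub (integrable_const L)).abs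
  -- After standardization, this `L¹` distance to a constant weight bounds the errors of numerator
  -- and denominator, whose values for the constant weight are `p * L` and `L`.
  set e := ∫ w, |G w - L| ∂γ with he
  have he0 : 0 ≤ e := integral_nonneg fun _ => abs_nonneg _
  obtain ⟨hai, ha1⟩ := integral_abs_gaussianReal_le
  have heC : e ≤ C * (1 + r) := by
    calc e ≤ ∫ w, C * (|w| + r) ∂γ :=
          integral_mono hGLi ((hai.add (integrable_const r)).const_mul C) hFL
      _ = C * (∫ w, |w| ∂γ + r) := by
          rw [integral_const_mul, integral_add hai (integrable_const r)]; simp [hγ]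
      _ ≤ C * (1 + r) := by gcongr
  have hDe : |∫ w, G w ∂γ - L| ≤ e := by
    have : ∫ w, G w ∂γ - L = ∫ w, (G w - L) ∂γ := by
      rw [integral_sub hGi (integrable_const L)]; simp
    rw [this]; exact abs_integral_le_integral_abs
  set p := cdf γ a with hp
  have hp01 : p ∈ Icc (0 : ℝ) 1 := ⟨cdf_nonneg _ _, cdf_le_one _ _⟩
  have hNe : |∫ w in Iic a, G w ∂γ - p * L| ≤ e := by
    have : ∫ w in Iic a, G w ∂γ - p * L = ∫ w in Iic a, (G w - L) ∂γ := by
      rw [integral_sub hGi.integrableOn (integrable_const L).integrableOn]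
      simp [hp, cdf_eq_real]
    rw [this]
    exact abs_integral_le_integral_abs.trans
      (setIntegral_le_integral hGLi (Eventually.of_forall fun _ => abs_nonneg _))
  have h01 := integral_Iic_div_integral_mem_Icc
    (f := fun u => gaussianPDFReal m v.toNNReal u * F u)
    (fun u => mul_nonneg (gaussianPDFReal_nonneg _ _ _) (hF01 u).1) (√v * a + m)
  rw [hN, hD] at h01 ⊢
  refine le_trans ?_ (b := 4 * e / c) (by gcongr)
  rw [le_div_iff₀ hc]
  set N := ∫ w in Iic a, G w ∂γ
  set D := ∫ w, G w ∂γ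
  -- If `2e ≤ c` the denominator is at least `c / 2`. Otherwise `4e / c > 2` exceeds the trivial
  -- bound `1`.
  by_cases hsmall : 2 * e ≤ c
  · have hDpos : c / 2 ≤ D := by linarith [(abs_le.1 hDe).1]
    have hD0 : 0 < D := by linarith
    have : |N / D - p| * D ≤ 2 * e := by
      have e3 : |N / D - p| * D = |(N - p * L) - p * (D - L)| := by
        rw [← abs_of_pos hD0, ← abs_mul, abs_of_pos hD0]
        congr 1; field_simp; ring
      rw [e3]
      refine (abs_sub _ _).trans ?_
      rw [abs_mul, abs_of_nonneg hp01.1]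
      have := mul_le_mul hp01.2 hDe (abs_nonneg _) zero_le_one
      linarith
    nlinarith [abs_nonneg (N / D - p)]
  · have : |N / D - p| ≤ 1 := abs_le.2 ⟨by linarith [h01.1, hp01.2], by linarith [h01.2, hp01.1]⟩
    nlinarith [abs_nonneg (N / D - p)]

end GaussianRatio

/-! ### Measurability and approximation of the weight and the pivot. -/

namespace TreeModel

variable {𝒳 : Type*} (M : TreeModel 𝒳)

lemma continuous_triple (h : Fin M.d) (s : Fin (M.alt h + 1)) :
    Continuous fun t : M.Coord → ℝ => M.triple t h s := by
  unfold triple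
  refine (continuous_apply _).prodMk ((continuous_apply _).prodMk ?_)
  split_ifs <;> fun_prop

lemma isOpen_gainDom (n : ℕ) : IsOpen (M.gainDom n) := by
  have : M.gainDom n = ⋂ h, ⋂ s, (fun t => M.triple t h s) ⁻¹' gainDomain (M.eta n h s) := by
    ext t; simp [gainDom]
  rw [this]
  refine isOpen_iInter_of_finite fun h => isOpen_iInter_of_finite fun s =>
    IsOpen.preimage (M.continuous_triple h s) ?_
  exact (isOpen_Ioo.preimage (by fun_prop)).inter
    ((isOpen_Ioo.preimage (by fun_prop)).inter (isOpen_Ioo.preimage (by fun_prop)))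

lemma continuousOn_gain (hi : M.InfoRegular) (n : ℕ) (h : Fin M.d) (s : Fin (M.alt h + 1)) :
    ContinuousOn (M.gain n h s) (M.gainDom n) := by
  have hI := M.continuousOn_info hi
  have ht := (M.continuous_triple h s).continuousOn (s := M.gainDom n)
  have h1 : ContinuousOn (fun t => (M.triple t h s).1) (M.gainDom n) := ht.fst
  have h2 : ContinuousOn (fun t => (M.triple t h s).2.1) (M.gainDom n) := ht.snd.fst
  have h3 : ContinuousOn (fun t => (M.triple t h s).2.2) (M.gainDom n) := ht.snd.snd
  unfold gain gainFun
  refine ((hI.comp (by fun_prop) fun t ht => (ht h s).1).sub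
    (continuousOn_const.mul (hI.comp (by fun_prop) fun t ht => (ht h s).2.1))).sub
    (continuousOn_const.mul (hI.comp (by fun_prop) fun t ht => (ht h s).2.2))

/-- `𝓘` is controlled on `(0, 1)` only, so measurability comes from continuity on the open gain
domain and the constant value off it. -/
lemma measurable_splitProb (hi : M.InfoRegular) (n : ℕ) (h : Fin M.d) :
    Measurable (M.splitProb n h) := by
  classical
  unfold splitProb
  rw [← piecewise_eq_indicator]
  refine ContinuousOn.measurable_piecewise ?_ continuousOn_const (M.isOpen_gainDom n).measurableSet
  have he (s) : ContinuousOn (fun t => Real.exp (M.eps h * M.gain n h s t)) (M.gainDom n) :=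
    (continuousOn_const.mul (M.continuousOn_gain hi n h s)).rexp
  exact (he 0).div (continuousOn_finsetSum _ fun s _ => he s) fun t _ =>
    (Finset.sum_pos (fun s _ => Real.exp_pos _) ⟨0, Finset.mem_univ _⟩).ne'

lemma measurable_pathProb (hi : M.InfoRegular) (n : ℕ) : Measurable (M.pathProb n) :=
  Finset.measurable_fun_prod _ fun h _ => M.measurable_splitProb hi n h

lemma measurable_mulVec {ι κ : Type*} [Fintype κ] (A : Matrix ι κ ℝ) :
    Measurable fun x : κ → ℝ => A.mulVec x := by
  refine measurable_pi_iff.2 fun i => ?_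
  unfold Matrix.mulVec dotProduct
  fun_prop

lemma measurable_Lam (hi : M.InfoRegular) (n : ℕ) : Measurable (M.Lam n) := by
  have : M.Lam n = fun x => M.pathProb n ((CFC.sqrt (M.cov n)).mulVec x + M.mean n) :=
    funext fun x => M.Lam_eq n x
  rw [this]
  exact (M.measurable_pathProb hi n).comp ((measurable_mulVec _).add_const _)

lemma measurableSet_stdDom (n : ℕ) : MeasurableSet (M.stdDom n) :=
  ((measurable_mulVec _).add_const _) (M.isOpen_gainDom n).measurableSet

/-- The key statistics with leading coordinate `u` and standardized nuisance part `x`. -/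
def profile (n : ℕ) (x : M.Coord → ℝ) (u : ℝ) : M.Coord → ℝ := fun c => c.elim u fun j =>
  (CFC.sqrt (M.covNuis n)).mulVec (fun j' => x (some j')) j + M.mean n (some j)

lemma pivotIntegrand_eq (n : ℕ) (x : M.Coord → ℝ) (u : ℝ) : M.pivotIntegrand n x u
    = gaussianPDFReal (M.mean n none) (M.varOne n).toNNReal u * M.pathProb n (M.profile n x u) :=
  rfl

lemma measurable_profile (n : ℕ) :
    Measurable fun p : (M.Coord → ℝ) × ℝ => M.profile n p.1 p.2 := by
  refine measurable_pi_iff.2 fun c => ?_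
  cases c with
  | none => exact measurable_snd
  | some j =>
    refine Measurable.add_const ?_ _
    refine ((measurable_pi_apply j).comp (measurable_mulVec (CFC.sqrt (M.covNuis n)))).comp ?_
    exact measurable_pi_iff.2 fun j' => (measurable_pi_apply _).comp measurable_fst

lemma measurable_pivot (hi : M.InfoRegular) (n : ℕ) : Measurable (M.pivot n) := by
  have hI : Measurable fun p : (M.Coord → ℝ) × ℝ => M.pivotIntegrand n p.1 p.2 := by
    simp only [pivotIntegrand_eq]
    exact ((measurable_gaussianPDFReal _ _).comp measurable_snd).mul
      ((M.measurable_pathProb hi n).comp (M.measurable_profile n))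
  refine Measurable.indicator ?_ (M.measurableSet_stdDom n)
  refine Measurable.div ?_ (hI.stronglyMeasurable.integral_prod_right' (ν := volume)).measurable
  -- The upper limit varies with `x`; an indicator on the product space turns the numerator into a
  -- parameter integral over the full line.
  have hs : MeasurableSet {p : (M.Coord → ℝ) × ℝ | p.2 ≤ √(M.varOne n) * p.1 none + M.mean n none} :=
    measurableSet_le (by fun_prop) (by fun_prop)
  have := ((hI.indicator hs).stronglyMeasurable.integral_prod_right' (ν := volume)).measurable
  refine (congrArg Measurable (funext fun x => ?_)).mp this
  rw [← integral_indicator measurableSet_Iic]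
  rfl

lemma pivot_mem_Icc (n : ℕ) (x : M.Coord → ℝ) : M.pivot n x ∈ Icc (0 : ℝ) 1 := by
  unfold pivot
  by_cases hx : x ∈ M.stdDom n
  · rw [indicator_of_mem hx]
    exact integral_Iic_div_integral_mem_Icc (fun u => mul_nonneg (gaussianPDFReal_nonneg _ _ _)
      (M.pathProb_mem_Icc n (M.profile n x u)).1) _
  · simp [hx]

/-- Near the mean of the key statistics the weight is nearly constant, and the pivot is nearly the
standard normal distribution function of the leading coordinate. -/
lemma exists_Lam_pivot_approx (hg : M.SampleGrowth) (hm : M.MeansBounded) (hc : M.CovNondegenerate)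
    (hi : M.InfoRegular) : ∃ C c : ℝ, 0 ≤ C ∧ 0 < c ∧ ∀ᶠ n : ℕ in atTop,
      c ≤ M.pathProb n (M.mean n) ∧ ∀ x : M.Coord → ℝ,
        |M.Lam n x - M.pathProb n (M.mean n)| ≤ C * (1 + ∑ c, |x c|) / √n ∧
        (x ∈ M.stdDom n →
          |M.pivot n x - cdf (gaussianReal 0 1) (x none)| ≤ C * (1 + ∑ c, |x c|) / √n) := by
  obtain ⟨C, c, hC, hc0, hCc⟩ := M.exists_pathProb_lipschitz hg hm hi
  obtain ⟨b, B, hb, hB, hspec⟩ := hc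
  refine ⟨max (C * B) (4 * (C * B) / c), c, (by positivity : 0 ≤ C * B).trans (le_max_left _ _),
    hc0, ?_⟩
  filter_upwards [hCc, hspec] with n hCc hspec
  obtain ⟨hcL, hlip⟩ := hCc
  obtain ⟨hpd, hspec⟩ := hspec
  have hdiag (i) : M.cov n i i ≤ B ^ 2 := diag_le_of_spectrum_le hpd (fun κ hκ => (hspec κ hκ).2.le) i
  have hnuis : (M.covNuis n).PosSemidef := hpd.posSemidef.submatrix some
  have hv : 0 < M.varOne n := hpd.diag_pos
  have hσB : √(M.varOne n) ≤ B := (Real.sqrt_le_left hB.le).2 (hdiag none)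
  refine ⟨hcL, fun x => ?_⟩
  set ρ := ∑ c, |x c| with hρ
  have hρ0 : 0 ≤ ρ := Finset.sum_nonneg fun _ _ => abs_nonneg _
  refine ⟨?_, fun hx => ?_⟩
  · rw [M.Lam_eq]
    refine (hlip _ (B * ρ) fun c => ?_).trans ?_
    · rw [Pi.add_apply, add_sub_cancel_right]
      exact abs_cfcSqrt_mulVec_le hpd.posSemidef hB.le hdiag x c
    · calc C * (B * ρ) / √n = (C * B) * ρ / √n := by ring
        _ ≤ max (C * B) (4 * (C * B) / c) * (1 + ρ) / √n := by
          gcongr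
          · exact le_max_left _ _
          · linarith
  · unfold pivot
    rw [indicator_of_mem hx]
    simp only [pivotIntegrand_eq]
    have hFm : Measurable fun u => M.pathProb n (M.profile n x u) :=
      (M.measurable_pathProb hi n).comp ((M.measurable_profile n).comp measurable_prodMk_left)
    refine (abs_gaussian_ratio_sub_cdf_le hFm (fun u => M.pathProb_mem_Icc n _) hv hc0 hcL
      (C := C * B / √n) (r := ρ) (by positivity) (fun w => ?_) (x none)).trans ?_
    -- The profile at `√v * w + m` differs from the mean by `σ_{n,1} w` in the leading coordinate
    -- and by `Σ_{n,-1}^{1/2} x_{-1}` in the others.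
    · refine (hlip _ (B * (|w| + ρ)) fun c => ?_).trans (by rw [← mul_assoc, mul_div_right_comm])
      cases c with
      | none =>
        simp only [profile, Option.elim, add_sub_cancel_right, abs_mul,
          abs_of_nonneg (Real.sqrt_nonneg _)]
        exact mul_le_mul hσB (by linarith) (abs_nonneg _) hB.le
      | some j =>
        simp only [profile, Option.elim, add_sub_cancel_right]
        refine (abs_cfcSqrt_mulVec_le hnuis hB.le (fun i => hdiag (some i)) _ j).trans ?_
        gcongr
        rw [hρ, Fintype.sum_option]
        linarith [abs_nonneg w, abs_nonneg (x none)]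
    · calc 4 * (C * B / √n * (1 + ρ)) / c = 4 * (C * B) / c * (1 + ρ) / √n := by ring
        _ ≤ _ := by
          gcongr
          exact le_max_right _ _

end TreeModel

/-! ### Linear form of the standardized statistics and reduction to the leading coordinate. -/

namespace TreeModel

variable {𝒳 : Type*} (M : TreeModel 𝒳)

/-- The weights of the outcomes in the standardized statistic. -/
def zetaWeight (n : ℕ) (c : M.Coord) (i : Fin n) : ℝ :=
  (1 / √(n : ℝ)) * (CFC.sqrt (M.cov n))⁻¹.mulVec (M.weight n i) c

lemma zeta_eq {n : ℕ} (hn : 0 < n) (y : Fin n → ℝ) (c : M.Coord) :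
    M.zeta n y c = ∑ i, M.zetaWeight n c i * (y i - M.theta n i) := by
  have h (c') : (M.keyStat n y - M.mean n) c'
      = (1 / √(n : ℝ)) * ∑ i, M.weight n i c' * (y i - M.theta n i) := by
    rw [Pi.sub_apply, M.keyStat_eq hn, mean]
    simp only [mul_sub, Finset.sum_sub_distrib]
  simp only [zeta, zetaWeight, Matrix.mulVec, dotProduct, h, Finset.mul_sum, Finset.sum_mul]
  rw [Finset.sum_comm]
  exact Finset.sum_congr rfl fun i _ => Finset.sum_congr rfl fun c' _ => by ring

lemma gaussStat_eq (n : ℕ) (z : Fin n → ℝ) (c : M.Coord) :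
    M.gaussStat n z c
      = ∑ i, M.zetaWeight n c i * √(M.theta n i * (1 - M.theta n i)) * z i := by
  simp only [gaussStat, stdWeight, zetaWeight, Pi.smul_apply, Finset.sum_apply, smul_eq_mul,
    Finset.mul_sum]
  exact Finset.sum_congr rfl fun i _ => by ring

/-- Each coordinate of the standardized statistic has variance one. -/
lemma sum_zetaWeight_sq {n : ℕ} (hpd : (M.cov n).PosDef) (c : M.Coord) :
    ∑ i, M.zetaWeight n c i ^ 2 * (M.theta n i * (1 - M.theta n i)) = 1 := by
  set T := (CFC.sqrt (M.cov n))⁻¹ with hT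
  have h1 := congrFun (congrFun (cfcSqrt_inv_mul_mul_inv hpd) c) c
  have hTt : T.transpose = T := by
    rw [hT, Matrix.transpose_nonsing_inv, transpose_cfcSqrt]
  have hTs (k l) : T k l = T l k := by
    conv_lhs => rw [← hTt]
    rfl
  have hn : (1 / √(n : ℝ)) ^ 2 = 1 / n := by
    rw [div_pow, one_pow, Real.sq_sqrt (Nat.cast_nonneg n)]
  rw [Matrix.one_apply_eq, ← hT] at h1
  refine Eq.trans ?_ h1
  simp only [Matrix.mul_apply, zetaWeight, mul_pow, hn, Matrix.mulVec, dotProduct, cov, ← hT]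
  simp only [sq, Finset.sum_mul, Finset.mul_sum]
  rw [Finset.sum_comm]
  refine Finset.sum_congr rfl fun k _ => ?_
  rw [Finset.sum_comm]
  refine Finset.sum_congr rfl fun l _ => Finset.sum_congr rfl fun i _ => ?_
  rw [hTs k c]
  ring

lemma abs_weight_le {n : ℕ} {K : ℝ} (hK : 1 ≤ K) (h1 : (n : ℝ) ≤ K * M.count n M.leafOne)
    (hs : ∀ h s, (n : ℝ) ≤ K * M.count n (M.child h s)) (i : Fin n) (c : M.Coord) :
    |M.weight n i c| ≤ K := by
  have hsqrt {R : Set 𝒳} (hR : (n : ℝ) ≤ K * M.count n R) : √(n / M.count n R) ≤ K := by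
    refine (Real.sqrt_le_left (by linarith)).2 ((div_le_of_le_mul₀ (M.count_nonneg _ _)
      (by linarith) hR).trans (by nlinarith))
  have hb {x y : ℝ} (hx : |x| ≤ 1) (hy0 : 0 ≤ y) (hy : y ≤ K) : |y * x| ≤ K := by
    rw [abs_mul, abs_of_nonneg hy0]
    nlinarith [abs_nonneg x]
  have i1 := M.ind_mem_Icc n M.leafOne i
  cases c with
  | none => exact hb (abs_le.2 ⟨by linarith [i1.1], i1.2⟩) (Real.sqrt_nonneg _) (hsqrt h1)
  | some c =>
    have hR : (n : ℝ) ≤ K * M.count n (M.region c) := by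
      unfold region
      split_ifs with hc
      -- `p_h` contains its observed branch, so it inherits the growth bound.
      · exact (hs c.1 0).trans (mul_le_mul_of_nonneg_left (M.count_mono (M.child_subset c.1 0))
          (by linarith))
      · exact hs c.1 c.2
    refine hb ?_ (Real.sqrt_nonneg _) (hsqrt hR)
    have iR := M.ind_mem_Icc n (M.region c) i
    have q0 : 0 ≤ M.count n (M.region c ∩ M.leafOne) / M.count n M.leafOne :=
      div_nonneg (M.count_nonneg _ _) (M.count_nonneg _ _)
    have q1 : M.count n (M.region c ∩ M.leafOne) / M.count n M.leafOne ≤ 1 :=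
      div_le_one_of_le₀ (M.count_mono inter_subset_right) (M.count_nonneg _ _)
    have q2 := mul_le_mul q1 i1.2 i1.1 zero_le_one
    have q3 := mul_nonneg q0 i1.1
    exact abs_le.2 ⟨by linarith [iR.1], by linarith [iR.2]⟩

lemma exists_abs_zetaWeight_le (hg : M.SampleGrowth) (hc : M.CovNondegenerate) :
    ∃ C : ℝ, ∀ᶠ n : ℕ in atTop, ∀ c i, |M.zetaWeight n c i| ≤ C / √n := by
  obtain ⟨K, hK1, hK⟩ := M.exists_growth hg
  obtain ⟨b, B, hb, hB, hspec⟩ := hc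
  refine ⟨∑ _c : M.Coord, b * K, ?_⟩
  filter_upwards [hK, hspec] with n hK hspec c i
  obtain ⟨-, h1, hs⟩ := hK
  obtain ⟨hpd, hspec⟩ := hspec
  have hrow := sum_sq_row_cfcSqrt_inv_le hpd hb (fun κ hκ => (hspec κ hκ).1.le) c
  have hT (j) : |(CFC.sqrt (M.cov n))⁻¹ c j| ≤ b :=
    abs_le_of_sq_le_sq ((Finset.single_le_sum
      (f := fun j => (CFC.sqrt (M.cov n))⁻¹ c j ^ 2) (fun _ _ => sq_nonneg _)
      (Finset.mem_univ j)).trans hrow) hb.le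
  have hm : |(CFC.sqrt (M.cov n))⁻¹.mulVec (M.weight n i) c| ≤ ∑ _c : M.Coord, b * K := by
    refine (Finset.abs_sum_le_sum_abs _ _).trans (Finset.sum_le_sum fun j _ => ?_)
    rw [abs_mul]
    exact mul_le_mul (hT j) (M.abs_weight_le hK1 h1 (fun h s => (hs h s).1) i j) (abs_nonneg _) hb.le
  unfold zetaWeight
  rw [abs_mul, abs_of_nonneg (by positivity), one_div, inv_mul_eq_div]
  gcongr

/-- Weighted test functions of the pivot may be replaced, up to an error of order `n^{-1/2}`, by
functions of the leading coordinate. -/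
lemma exists_test_approx (hg : M.SampleGrowth) (hm : M.MeansBounded) (hc : M.CovNondegenerate)
    (hi : M.InfoRegular) {h : ℝ → ℝ} (hh : ContDiff ℝ 3 h) : ∃ C : ℝ, 0 ≤ C ∧
      ∀ᶠ n : ℕ in atTop, ∀ x : M.Coord → ℝ,
        |h (M.pivot n x) * M.Lam n x - h (cdf (gaussianReal 0 1) (x none)) * M.pathProb n (M.mean n)|
          ≤ C * (1 + ∑ c, |x c|) / √n := by
  obtain ⟨C, c, hC, -, hev⟩ := M.exists_Lam_pivot_approx hg hm hc hi
  obtain ⟨B, hB⟩ := isCompact_Icc.exists_bound_of_continuousOn (s := Icc (0 : ℝ) 1)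
    hh.continuous.continuousOn
  obtain ⟨H, hH⟩ := isCompact_Icc.exists_bound_of_continuousOn (s := Icc (0 : ℝ) 1)
    (hh.continuous_deriv (by norm_num)).continuousOn
  have hB0 : 0 ≤ B := (norm_nonneg _).trans (hB 0 (by simp))
  have hH0 : 0 ≤ H := (norm_nonneg _).trans (hH 0 (by simp))
  have hLip (p) (hp : p ∈ Icc (0 : ℝ) 1) (q) (hq : q ∈ Icc (0 : ℝ) 1) :
      |h p - h q| ≤ H * |p - q| := by
    have := (convex_Icc (0 : ℝ) 1).norm_image_sub_le_of_norm_deriv_le (f := h) (C := H)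
      (fun z _ => (hh.differentiable (by norm_num)).differentiableAt) hH hq hp
    simpa using this
  refine ⟨H * C + B * C, by positivity, ?_⟩
  filter_upwards [hev] with n hev x
  obtain ⟨h1, h2⟩ := hev.2 x
  set L := M.pathProb n (M.mean n)
  set p := cdf (gaussianReal 0 1) (x none)
  have hp : p ∈ Icc (0 : ℝ) 1 := ⟨cdf_nonneg _ _, cdf_le_one _ _⟩
  have hΛ : M.Lam n x ∈ Icc (0 : ℝ) 1 := by rw [M.Lam_eq]; exact M.pathProb_mem_Icc n _
  have hBp : |h p| ≤ B := hB p hp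
  set E := C * (1 + ∑ c, |x c|) / √n with hE
  have hEE : (H * C + B * C) * (1 + ∑ c, |x c|) / √n = H * E + B * E := by rw [hE]; ring
  have hE0 : 0 ≤ E := (abs_nonneg _).trans h1
  have e : h (M.pivot n x) * M.Lam n x - h p * L
      = (h (M.pivot n x) - h p) * M.Lam n x + h p * (M.Lam n x - L) := by ring
  rw [hEE, e]
  refine (abs_add_le _ _).trans (add_le_add ?_ ?_)
  · by_cases hx : x ∈ M.stdDom n
    · rw [abs_mul, abs_of_nonneg hΛ.1]
      calc _ ≤ |h (M.pivot n x) - h p| * 1 := by gcongr; exact hΛ.2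
        _ ≤ H * |M.pivot n x - p| := by rw [mul_one]; exact hLip _ (M.pivot_mem_Icc n x) _ hp
        _ ≤ H * E := by gcongr; exact h2 hx
    -- Off `D_n` the pivot has a default value unrelated to `Φ`, but it is multiplied by a vanishing
    -- weight.
    · have : M.Lam n x = 0 := indicator_of_notMem hx _
      rw [this, mul_zero, abs_zero]; positivity
  · rw [abs_mul]
    exact mul_le_mul hBp h1 (abs_nonneg _) hB0

lemma exists_bound_test {h : ℝ → ℝ} (hh : Continuous h) : ∃ B : ℝ, ∀ n (x : M.Coord → ℝ),
    ‖h (M.pivot n x) * M.Lam n x‖ ≤ B := by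
  obtain ⟨B, hB⟩ := isCompact_Icc.exists_bound_of_continuousOn (s := Icc (0 : ℝ) 1) hh.continuousOn
  refine ⟨B, fun n x => ?_⟩
  have h1 := hB _ (M.pivot_mem_Icc n x)
  have hΛ : M.Lam n x ∈ Icc (0 : ℝ) 1 := by rw [M.Lam_eq]; exact M.pathProb_mem_Icc n _
  rw [norm_mul, Real.norm_of_nonneg hΛ.1]
  nlinarith [norm_nonneg (h (M.pivot n x)), hΛ.1, hΛ.2]

/-- `h ∘ Φ` as a bounded continuous function. -/
lemma exists_boundedContinuous_comp_cdf {h : ℝ → ℝ} (hh : Continuous h) :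
    ∃ f : BoundedContinuousFunction ℝ ℝ, ∀ a, f a = h (cdf (gaussianReal 0 1) a) := by
  obtain ⟨B, hB⟩ := isCompact_Icc.exists_bound_of_continuousOn (s := Icc (0 : ℝ) 1) hh.continuousOn
  have : NullSingletonClass (gaussianReal 0 1) := nullSingletonClass_gaussianReal one_ne_zero
  exact ⟨BoundedContinuousFunction.ofNormedAddCommGroup (fun a => h (cdf (gaussianReal 0 1) a))
    (hh.comp (continuous_cdf_of_noAtoms _)) B fun a => hB _ ⟨cdf_nonneg _ _, cdf_le_one _ _⟩,
    fun a => rfl⟩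

section Limit

variable {Ω : ℕ → Type*} [∀ n, MeasurableSpace (Ω n)] {μ : ∀ n, Measure (Ω n)}
  [∀ n, IsProbabilityMeasure (μ n)]

lemma integrable_test (hi : M.InfoRegular) {h : ℝ → ℝ} (hh : Continuous h) {n : ℕ}
    {x : Ω n → M.Coord → ℝ} (hx : AEMeasurable x (μ n)) :
    Integrable (fun ω => h (M.pivot n (x ω)) * M.Lam n (x ω)) (μ n) := by
  obtain ⟨B, hB⟩ := M.exists_bound_test hh
  have hF : Measurable fun x => h (M.pivot n x) * M.Lam n x :=
    (hh.measurable.comp (M.measurable_pivot hi n)).mul (M.measurable_Lam hi n)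
  exact Integrable.of_bound (hF.comp_aemeasurable hx).aestronglyMeasurable B
    (Eventually.of_forall fun ω => hB n (x ω))

/-- The pointwise estimate is integrated. The vector `x n` enters only through its first moments, so
the lemma covers `ζ_n` and `Z_n` alike. -/
lemma tendsto_integral_test_sub (hg : M.SampleGrowth) (hm : M.MeansBounded)
    (hc : M.CovNondegenerate) (hi : M.InfoRegular) {h : ℝ → ℝ} (hh : ContDiff ℝ 3 h)
    {f : BoundedContinuousFunction ℝ ℝ} (hf : ∀ a, f a = h (cdf (gaussianReal 0 1) a))
    {x : ∀ n, Ω n → M.Coord → ℝ} (hx : ∀ᶠ n in atTop, ∀ c,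
      Integrable (fun ω => x n ω c) (μ n) ∧ ∫ ω, |x n ω c| ∂(μ n) ≤ 1) :
    Tendsto (fun n => ∫ ω, h (M.pivot n (x n ω)) * M.Lam n (x n ω) ∂(μ n)
      - M.pathProb n (M.mean n) * ∫ ω, f (x n ω none) ∂(μ n)) atTop (𝓝 0) := by
  obtain ⟨C, hC, hev⟩ := M.exists_test_approx hg hm hc hi hh
  have hlim : Tendsto (fun n : ℕ => (√n)⁻¹) atTop (𝓝 0) :=
    tendsto_inv_atTop_zero.comp (Real.tendsto_sqrt_atTop.comp tendsto_natCast_atTop_atTop)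
  refine squeeze_zero_norm' (a := fun n : ℕ => C * (1 + Fintype.card M.Coord) * (√n)⁻¹) ?_
    (by simpa using hlim.const_mul (C * (1 + Fintype.card M.Coord)))
  filter_upwards [hev, hx] with n hev hx
  have hxm : AEMeasurable (x n) (μ n) := aemeasurable_pi_iff.2 fun c => (hx c).1.aemeasurable
  have hF := M.integrable_test hi hh.continuous hxm
  have hfi : Integrable (fun ω => f (x n ω none)) (μ n) :=
    Integrable.of_bound (f.continuous.measurable.comp_aemeasurable
      (hx none).1.aemeasurable).aestronglyMeasurable ‖f‖
      (Eventually.of_forall fun ω => f.norm_coe_le_norm _)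
  have hsum : Integrable (fun ω => 1 + ∑ c, |x n ω c|) (μ n) :=
    (integrable_const 1).add (integrable_finsetSum _ fun c _ => (hx c).1.abs)
  rw [← integral_const_mul, ← integral_sub hF (hfi.const_mul _)]
  calc _ ≤ ∫ ω, C * (1 + ∑ c, |x n ω c|) / √n ∂(μ n) := by
        refine norm_integral_le_of_norm_le ((hsum.const_mul C).div_const _)
          (Eventually.of_forall fun ω => ?_)
        rw [hf, mul_comm (M.pathProb n (M.mean n))]
        exact hev (x n ω)
    _ = C * (1 + ∑ c, ∫ ω, |x n ω c| ∂(μ n)) / √n := by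
        rw [integral_div, integral_const_mul, integral_add (integrable_const 1)
          (integrable_finsetSum _ fun c _ => (hx c).1.abs),
          integral_finsetSum _ fun c _ => (hx c).1.abs]
        simp
    _ ≤ C * (1 + ∑ _c : M.Coord, 1) / √n := by
        gcongr with c
        exact (hx c).2
    _ = _ := by simp [div_eq_mul_inv]

end Limit

end TreeModel

end

/-! ### The theorem. -/

theorem theorem2 {𝒳 : Type*} (M : TreeModel 𝒳)
    {Ω : ℕ → Type*} [∀ n, MeasurableSpace (Ω n)]
    (μ : ∀ n, Measure (Ω n)) [∀ n, IsProbabilityMeasure (μ n)]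
    (Y Z : ∀ n : ℕ, Fin n → Ω n → ℝ)
    (hY_indep : ∀ n, iIndepFun (Y n) (μ n))
    (hY_law : ∀ n i, IsBernoulli (μ n) (Y n i) (M.theta n i))
    (hZ_indep : ∀ n, iIndepFun (Z n) (μ n))
    (hZ_law : ∀ n i, HasLaw (Z n i) (gaussianReal 0 1) (μ n))
    (h_growth : M.SampleGrowth) (h_means : M.MeansBounded)
    (h_cov : M.CovNondegenerate) (h_info : M.InfoRegular) :
    -- the expectations that enter the relative differences exist, and the denominator is positive
    (∀ᶠ n in atTop,
      Integrable (fun ω => M.Lam n (M.zeta n fun i => Y n i ω)) (μ n) ∧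
      Integrable (fun ω => M.Lam n (M.gaussStat n fun i => Z n i ω)) (μ n) ∧
      0 < ∫ ω, M.Lam n (M.gaussStat n fun i => Z n i ω) ∂(μ n)) ∧
    -- the first relative difference
    Tendsto (fun n =>
      |∫ ω, M.Lam n (M.zeta n fun i => Y n i ω) ∂(μ n)
          - ∫ ω, M.Lam n (M.gaussStat n fun i => Z n i ω) ∂(μ n)|
        / ∫ ω, M.Lam n (M.gaussStat n fun i => Z n i ω) ∂(μ n)) atTop (𝓝 0) ∧
    -- the second relative difference, for every test function `h`
    ∀ h : ℝ → ℝ, ContDiff ℝ 3 h →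
      (∀ᶠ n in atTop,
        Integrable (fun ω => h (M.pivot n (M.zeta n fun i => Y n i ω))
          * M.Lam n (M.zeta n fun i => Y n i ω)) (μ n) ∧
        Integrable (fun ω => h (M.pivot n (M.gaussStat n fun i => Z n i ω))
          * M.Lam n (M.gaussStat n fun i => Z n i ω)) (μ n)) ∧
      Tendsto (fun n =>
        |∫ ω, h (M.pivot n (M.zeta n fun i => Y n i ω))
              * M.Lam n (M.zeta n fun i => Y n i ω) ∂(μ n)
            - ∫ ω, h (M.pivot n (M.gaussStat n fun i => Z n i ω))
              * M.Lam n (M.gaussStat n fun i => Z n i ω) ∂(μ n)|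
          / ∫ ω, M.Lam n (M.gaussStat n fun i => Z n i ω) ∂(μ n)) atTop (𝓝 0) := by
  obtain ⟨_, _, -, -, hspec⟩ := id h_cov
  obtain ⟨W, hW⟩ := M.exists_abs_zetaWeight_le h_growth h_cov
  obtain ⟨_, c₀, -, hc₀, hL⟩ := M.exists_pathProb_lipschitz h_growth h_means h_info
  have hpd : ∀ᶠ n in atTop, (M.cov n).PosDef := hspec.mono fun n h => h.1
  have hθ (n i) : 0 ≤ M.theta n i * (1 - M.theta n i) := by
    obtain ⟨h0, h1⟩ := (hY_law n i).mem_Icc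
    exact mul_nonneg h0 (by linarith)
  have hvarZ {n} (hpd : (M.cov n).PosDef) (c) :
      ∑ i, (M.zetaWeight n c i * √(M.theta n i * (1 - M.theta n i))) ^ 2 = 1 := by
    refine Eq.trans ?_ (M.sum_zetaWeight_sq hpd c)
    exact Finset.sum_congr rfl fun i _ => by rw [mul_pow, Real.sq_sqrt (hθ n i)]
  have hζ : ∀ᶠ n in atTop, ∀ c, Integrable (fun ω => M.zeta n (fun i => Y n i ω) c) (μ n) ∧
      ∫ ω, |M.zeta n (fun i => Y n i ω) c| ∂(μ n) ≤ 1 := by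
    filter_upwards [hpd, eventually_gt_atTop 0] with n hpd hn c
    simp only [M.zeta_eq hn]
    exact integral_abs_sum_bernoulli_le (hY_indep n) (hY_law n) (M.sum_zetaWeight_sq hpd c)
  have hZ : ∀ᶠ n in atTop, ∀ c, Integrable (fun ω => M.gaussStat n (fun i => Z n i ω) c) (μ n) ∧
      ∫ ω, |M.gaussStat n (fun i => Z n i ω) c| ∂(μ n) ≤ 1 := by
    filter_upwards [hpd] with n hpd c
    simp only [M.gaussStat_eq]
    exact integral_abs_sum_gaussian_le (hZ_indep n) (hZ_law n) (hvarZ hpd c)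
  have hint {h : ℝ → ℝ} (hh : Continuous h) : ∀ᶠ n in atTop,
      Integrable (fun ω => h (M.pivot n (M.zeta n fun i => Y n i ω))
        * M.Lam n (M.zeta n fun i => Y n i ω)) (μ n) ∧
      Integrable (fun ω => h (M.pivot n (M.gaussStat n fun i => Z n i ω))
        * M.Lam n (M.gaussStat n fun i => Z n i ω)) (μ n) := by
    filter_upwards [hζ, hZ] with n hζ hZ
    exact ⟨M.integrable_test h_info hh (aemeasurable_pi_iff.2 fun c => (hζ c).1.aemeasurable),
      M.integrable_test h_info hh (aemeasurable_pi_iff.2 fun c => (hZ c).1.aemeasurable)⟩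
  -- For `h = 1` the approximation says `E[Λ(Z_n)] - L_n → 0`, and `L_n ≥ c₀`.
  have hdenom : ∀ᶠ n in atTop, c₀ / 2 ≤ ∫ ω, M.Lam n (M.gaussStat n fun i => Z n i ω) ∂(μ n) := by
    obtain ⟨f, hf⟩ := TreeModel.exists_boundedContinuous_comp_cdf (h := fun _ => 1) continuous_const
    have := M.tendsto_integral_test_sub h_growth h_means h_cov h_info (h := fun _ => 1)
      contDiff_const hf hZ
    simp only [hf, one_mul, integral_const, probReal_univ, smul_eq_mul, mul_one] at this
    filter_upwards [this.eventually (eventually_gt_nhds (show -(c₀ / 2) < 0 by linarith)), hL]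
      with n h1 h2
    linarith [h2.1]
  have hlim {h : ℝ → ℝ} (hh : ContDiff ℝ 3 h) : Tendsto (fun n =>
      |∫ ω, h (M.pivot n (M.zeta n fun i => Y n i ω))
            * M.Lam n (M.zeta n fun i => Y n i ω) ∂(μ n)
          - ∫ ω, h (M.pivot n (M.gaussStat n fun i => Z n i ω))
            * M.Lam n (M.gaussStat n fun i => Z n i ω) ∂(μ n)|
        / ∫ ω, M.Lam n (M.gaussStat n fun i => Z n i ω) ∂(μ n)) atTop (𝓝 0) := by
    obtain ⟨f, hf⟩ := TreeModel.exists_boundedContinuous_comp_cdf hh.continuous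
    have t1 := M.tendsto_integral_test_sub h_growth h_means h_cov h_info hh hf hζ
    have t2 := M.tendsto_integral_test_sub h_growth h_means h_cov h_info hh hf hZ
    -- The first integral converges to the Gaussian one by the central limit theorem; the second
    -- eventually equals it.
    have t3 : Tendsto (fun n => ∫ ω, f (M.zeta n (fun i => Y n i ω) none) ∂(μ n)
        - ∫ ω, f (M.gaussStat n (fun i => Z n i ω) none) ∂(μ n)) atTop (𝓝 0) := by
      have clt := tendsto_integral_sum_bernoulli (w := fun n i => M.zetaWeight n none i) hY_indep
        hY_law (hW.mono fun n h => h none)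
        (hpd.mono fun n h => M.sum_zetaWeight_sq h none) f
      have := clt.sub_const (∫ x, f x ∂(gaussianReal 0 1))
      rw [sub_self] at this
      refine this.congr' ?_
      filter_upwards [hpd, eventually_gt_atTop 0] with n hpd hn
      simp only [M.zeta_eq hn, M.gaussStat_eq]
      congr 1
      exact ((hasLaw_sum_gaussian (hZ_indep n) (hZ_law n) (hvarZ hpd none)).integral_comp
        (f := f) f.continuous.aestronglyMeasurable).symm
    have t4 : Tendsto (fun n => M.pathProb n (M.mean n)
        * (∫ ω, f (M.zeta n (fun i => Y n i ω) none) ∂(μ n)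
          - ∫ ω, f (M.gaussStat n (fun i => Z n i ω) none) ∂(μ n))) atTop (𝓝 0) := by
      refine squeeze_zero_norm (fun n => ?_) (tendsto_zero_iff_norm_tendsto_zero.1 t3)
      have := M.pathProb_mem_Icc n (M.mean n)
      rw [norm_mul, Real.norm_of_nonneg this.1]
      exact mul_le_of_le_one_left (norm_nonneg _) this.2
    -- In this combination the terms with `L_n` cancel, leaving the difference of the two
    -- expectations.
    have t5 := ((t1.sub t2).add t4).abs.div_const (c₀ / 2)
    simp only [sub_zero, add_zero, abs_zero, zero_div] at t5
    refine squeeze_zero' ?_ ?_ t5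
    · filter_upwards [hdenom] with n hn
      exact div_nonneg (abs_nonneg _) (by linarith)
    · filter_upwards [hdenom] with n hn
      refine (div_le_div_of_nonneg_left (abs_nonneg _) (by linarith) hn).trans (le_of_eq ?_)
      congr 2
      ring
  refine ⟨?_, ?_, fun h hh => ⟨hint hh.continuous, hlim hh⟩⟩
  · filter_upwards [hint (h := fun _ => 1) continuous_const, hdenom] with n hn hd
    simp only [one_mul] at hn
    exact ⟨hn.1, hn.2, by linarith⟩
  · simpa only [one_mul] using hlim (h := fun _ => 1) contDiff_const
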